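/- Let $K$ be a field of characteristic $0$, $n\ge 2$, and $d\in K$ with $d\notin\{0,-2,-4,\dots,-2n+4\}$ (for example $K=\mathbb{C}(d)$ with $d$ an indeterminate). The virtual Temperley–Lieb (Brauer) algebra $VTL_m(d)$ over $K$ has as basis the perfect matchings ("diagrams") of $m$ top points and $m$ bottom points; the product $XY$ of two diagrams is obtained by stacking $X$ on top of $Y$, identifying the bottom points of $X$ with the top points of $Y$, and replacing every closed curve by a factor $d$. For $1\le i\le m-1$, $e_i$ is the diagram with one arc joining the top points $i,i+1$, one arc joining the bottom points $i,i+1$, and vertical strands elsewhere, and $v_i$ is the diagram in which strands $i$ and $i+1$ cross and all other strands are vertical. Let $1_m$ be the diagram with $m$ vertical strands. The projector $f_m\in VTL_m(d)$ ($1\le m\le n$) is the last term of the sequence $f_1,\dots,f_m\in VTL_m(d)$ defined by $f_1=1_m$ and $$f_{i+1}=\tfrac{1}{i+1}\,f_i-\tfrac{2i}{(i+1)(d+2i-2)}\,f_ie_if_i+\tfrac{i}{i+1}\,f_iv_if_i\qquad(1\le i<m).$$ A $k$-element is a diagram with exactly $k$ arcs joining a top point to a bottom point. Let $0\le k\le n-2$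 with $n-k$ even. Then the canonical $k$-element $\mathcal{CE}_n^k=e_{k+1}e_{k+3}\cdots e_{n-1}$ is a single diagram of $VTL_n(d)$, with $k$ through strands; all $(k+1)$-elements of $VTL_{n-1}(d)$ (there is at least one) have the same coefficient $c$ in $f_{n-1}$; and the coefficient of $\mathcal{CE}_n^k$ in $f_n$ equals $$\left\lfloor \frac{n-k}{2}\right\rfloor\cdot\frac{-2}{n(d+2n-4)}\cdot c .$$ -/

import Mathlib

namespace VirtualTL

/-- A connection diagram on `n` strands up to virtual isotopy: a perfect matching of the `n` top
points `Sum.inl i` and the `n` bottom points `Sum.inr i`, given as a fixed-point free involution. -/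
@[ext]
structure Diagram (n : ℕ) where
  mate : Equiv.Perm (Fin n ⊕ Fin n)
  mate_mate : ∀ x, mate (mate x) = x
  mate_ne : ∀ x, mate x ≠ x

/-- The number of through strands, i.e. of arcs joining a top point to a bottom point. -/
def Diagram.through {n : ℕ} (D : Diagram n) : ℕ :=
  (Finset.univ.filter fun i : Fin n => (D.mate (Sum.inl i)).isRight = true).card

/-- The points of two stacked diagrams: top row, middle row, bottom row. -/
abbrev Stack (n : ℕ) : Type := Fin n ⊕ (Fin n ⊕ Fin n)

/-- The top and bottom points among the points of the stack. -/
def outer {n : ℕ} : Fin n ⊕ Fin n → Stack n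
  | Sum.inl i => Sum.inl i
  | Sum.inr i => Sum.inr (Sum.inr i)

/-- The arcs of the diagram placed in the upper half of the stack (bottom row fixed). -/
def Diagram.upper {n : ℕ} (X : Diagram n) : Equiv.Perm (Stack n) :=
  (Equiv.sumAssoc (Fin n) (Fin n) (Fin n)).permCongr (Equiv.sumCongr X.mate (Equiv.refl (Fin n)))

/-- The arcs of the diagram placed in the lower half of the stack (top row fixed). -/
def Diagram.lower {n : ℕ} (Y : Diagram n) : Equiv.Perm (Stack n) :=
  Equiv.sumCongr (Equiv.refl (Fin n)) Y.mate

/-- Two points of the stack of `X` on top of `Y` are related if they lie on the same connected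
component of the resulting one-dimensional manifold. -/
def strand {n : ℕ} (X Y : Diagram n) : Setoid (Stack n) :=
  Relation.EqvGen.setoid fun s t => X.upper s = t ∨ Y.lower s = t

/-- The number of closed curves created by stacking `X` on top of `Y`: the number of connected
components that contain neither a top point nor a bottom point. -/
noncomputable def loops {n : ℕ} (X Y : Diagram n) : ℕ :=
  Nat.card {c : Quotient (strand X Y) // ∀ p, Quotient.mk (strand X Y) (outer p) ≠ c}

/-- Combinatorial core of composition: a path made of alternating steps of two involutions. -/
theorem exists_end {S : Type*} [Finite S] (a b : Equiv.Perm S)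
    (ha : ∀ s, a (a s) = s) (hb : ∀ s, b (b s) = s) (hab : ∀ s, ¬ (a s = s ∧ b s = s))
    (v : S) (hv : b v = v) :
    ∃ w, w ≠ v ∧ (a w = w ∨ b w = w) ∧
      Relation.EqvGen (fun s t => a s = t ∨ b s = t) v w ∧
      ∀ u, Relation.EqvGen (fun s t => a s = t ∨ b s = t) v u → (a u = u ∨ b u = u) →
        u = v ∨ u = w := by
  set r : Equiv.Perm S := a * b with hr
  have ha2 : a * a = 1 := by ext s; simp [ha]
  have hb2 : b * b = 1 := by ext s; simp [hb]
  have ha' : a⁻¹ = a := inv_eq_of_mul_eq_one_left ha2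
  have hb' : b⁻¹ = b := inv_eq_of_mul_eq_one_left hb2
  have hrinv : r⁻¹ = b * a := by rw [hr, mul_inv_rev, ha', hb']
  have hconj : ∀ k : ℤ, b * r ^ k = r ^ (-k) * b := by
    intro k
    have h1 : b * r * b⁻¹ = r⁻¹ := by rw [hrinv, hr, hb']; rw [mul_assoc, mul_assoc, hb2, mul_one]
    have h2 : b * r ^ k * b⁻¹ = r ^ (-k) := by
      rw [← conj_zpow, h1, inv_zpow, zpow_neg]
    rw [← h2]; group
  have hbk : ∀ k : ℤ, b ((r ^ k) v) = (r ^ (-k)) v := by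
    intro k
    have := congrArg (fun g : Equiv.Perm S => g v) (hconj k)
    simpa [hv] using this
  have hak : ∀ k : ℤ, a ((r ^ k) v) = (r ^ (1 - k)) v := by
    intro k
    have h1 : a = r * b := by rw [hr, mul_assoc, hb2, mul_one]
    have h2 : a ((r ^ k) v) = r (b ((r ^ k) v)) := by
      conv_lhs => rw [h1]
      rfl
    rw [h2, hbk, sub_eq_add_neg, zpow_add, zpow_one]; rfl
  have heqv : ∀ s t : S, s = t → ∀ c, Relation.EqvGen (fun s t => a s = t ∨ b s = t) c s →
      Relation.EqvGen (fun s t => a s = t ∨ b s = t) c t := by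
    rintro s t rfl c h; exact h
  have hreach : ∀ k : ℕ,
      Relation.EqvGen (fun s t => a s = t ∨ b s = t) v ((r ^ (k : ℤ)) v) := by
    intro k
    induction k with
    | zero => simpa using Relation.EqvGen.refl v
    | succ k ih =>
      refine Relation.EqvGen.trans _ _ _ ih ?_
      refine Relation.EqvGen.trans _ (b ((r ^ (k : ℤ)) v)) _
        (Relation.EqvGen.rel _ _ (Or.inr rfl)) (Relation.EqvGen.rel _ _ (Or.inl ?_))
      rw [hbk, hak]; push_cast; congr 2; ring
  have hback : ∀ s t : S, Relation.EqvGen (fun s t => a s = t ∨ b s = t) s t →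
      ((∃ k : ℤ, s = (r ^ k) v) ↔ ∃ k : ℤ, t = (r ^ k) v) := by
    intro s t h
    induction h with
    | rel s t h =>
      constructor
      · rintro ⟨k, rfl⟩
        rcases h with h | h
        · exact ⟨1 - k, by rw [← h, hak]⟩
        · exact ⟨-k, by rw [← h, hbk]⟩
      · rintro ⟨k, rfl⟩
        rcases h with h | h
        · exact ⟨1 - k, by rw [← hak, ← h, ha]⟩
        · exact ⟨-k, by rw [← hbk, ← h, hb]⟩
    | refl s => exact Iff.rfl
    | symm s t _ ih => exact ih.symm
    | trans s t u _ _ ih1 ih2 => exact ih1.trans ih2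
  set N := Function.minimalPeriod (r • ·) v with hN
  have hper : ∀ k l : ℤ, (r ^ k) v = (r ^ l) v ↔ (N : ℤ) ∣ k - l := by
    intro k l
    rw [hN, ← MulAction.zpow_smul_eq_iff_minimalPeriod_dvd]
    rw [Equiv.Perm.smul_def, sub_eq_neg_add, zpow_add, zpow_neg, Equiv.Perm.mul_apply,
      Equiv.Perm.inv_eq_iff_eq]
  have hNpos : 0 < N := by
    rw [hN]
    refine Function.minimalPeriod_pos_of_mem_periodicPts ?_
    exact ((MulAction.injective r).mem_periodicPts v)
  have hv0 : (r ^ (0 : ℤ)) v = v := by simp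
  have hN1 : N ≠ 1 := by
    intro h1
    refine hab v ⟨?_, hv⟩
    have h2 := hak 0
    rw [hv0] at h2
    rw [h2]
    have := (hper (1 - 0) 0).2 (by rw [h1]; simp)
    rw [this, hv0]
  have hiffb : ∀ k : ℤ, b ((r ^ k) v) = (r ^ k) v ↔ (N : ℤ) ∣ 2 * k := by
    intro k
    rw [hbk, hper, ← dvd_neg]; ring_nf
  have hiffa : ∀ k : ℤ, a ((r ^ k) v) = (r ^ k) v ↔ (N : ℤ) ∣ 2 * k - 1 := by
    intro k
    rw [hak, hper, ← dvd_neg]; ring_nf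
  refine ⟨(r ^ (((N + 1) / 2 : ℕ) : ℤ)) v, ?_, ?_, hreach _, ?_⟩
  · intro h
    have h' := (hper _ 0).1 (h.trans hv0.symm)
    have h2 : N ∣ (N + 1) / 2 := by
      rw [sub_zero] at h'; exact_mod_cast h'
    have := Nat.le_of_dvd (by omega) h2
    omega
  · rcases Nat.even_or_odd' N with ⟨m, hm | hm⟩
    · right
      rw [hiffb]
      refine ⟨1, ?_⟩
      omega
    · left
      rw [hiffa]
      refine ⟨1, ?_⟩
      omega
  · intro u hu hfix
    obtain ⟨k, rfl⟩ := (hback v u hu).1 ⟨0, hv0.symm⟩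
    have key : (N : ℤ) ∣ k ∨ (N : ℤ) ∣ k - (((N + 1) / 2 : ℕ) : ℤ) := by
      rcases hfix with h | h
      · obtain ⟨q, hq⟩ := (hiffa k).1 h
        right
        rcases Nat.even_or_odd' N with ⟨m, hm | hm⟩
        · exfalso
          have : (N : ℤ) * q = 2 * (m * q) := by rw [hm]; push_cast; ring
          omega
        · have h1 : (((N + 1) / 2 : ℕ) : ℤ) = m + 1 := by omega
          rcases Int.even_or_odd' q with ⟨p, hp | hp⟩
          · exfalso
            have : (N : ℤ) * q = 2 * (N * p) := by rw [hp]; ring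
            omega
          · refine ⟨p, ?_⟩
            rw [h1]
            have h2 : (N : ℤ) = 2 * m + 1 := by omega
            have : (N : ℤ) * q = 2 * (N * p) + N := by rw [hp]; ring
            omega
      · obtain ⟨q, hq⟩ := (hiffb k).1 h
        rcases Int.even_or_odd' q with ⟨p, hp | hp⟩
        · left
          refine ⟨p, ?_⟩
          have : (N : ℤ) * q = 2 * (N * p) := by rw [hp]; ring
          omega
        · right
          refine ⟨p, ?_⟩
          have : (N : ℤ) * q = 2 * (N * p) + N := by rw [hp]; ring
          omega
    rcases key with h | h
    · left
      have := (hper k 0).2 (by simpa using h)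
      rw [this, hv0]
    · right
      exact (hper _ _).2 h

theorem upper_upper {n : ℕ} (X : Diagram n) (s : Stack n) : X.upper (X.upper s) = s := by
  rcases s with i | i | i <;> simp [Diagram.upper, Equiv.permCongr_apply, X.mate_mate]

theorem lower_lower {n : ℕ} (Y : Diagram n) (s : Stack n) : Y.lower (Y.lower s) = s := by
  rcases s with i | i | i <;> simp [Diagram.lower, Y.mate_mate]

theorem upper_fixed {n : ℕ} (X : Diagram n) (s : Stack n) :
    X.upper s = s ↔ ∃ i, s = Sum.inr (Sum.inr i) := by
  rcases s with i | i | i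
  · simp only [Diagram.upper, Equiv.permCongr_apply, reduceCtorEq,
      exists_false, iff_false]
    intro h
    have h' := (Equiv.sumAssoc (Fin n) (Fin n) (Fin n)).injective
      (h.trans (Equiv.sumAssoc_apply_inl_inl i).symm)
    simp [X.mate_ne] at h'
  · simp only [Diagram.upper, Equiv.permCongr_apply, Sum.inr.injEq, reduceCtorEq,
      exists_false, iff_false]
    intro h
    have h' := (Equiv.sumAssoc (Fin n) (Fin n) (Fin n)).injective
      (h.trans (Equiv.sumAssoc_apply_inl_inr i).symm)
    simp [X.mate_ne] at h'
  · simp [Diagram.upper, Equiv.permCongr_apply]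

theorem lower_fixed {n : ℕ} (Y : Diagram n) (s : Stack n) :
    Y.lower s = s ↔ ∃ i, s = Sum.inl i := by
  rcases s with i | i
  · simp [Diagram.lower]
  · simp [Diagram.lower, Y.mate_ne]

theorem fixed_iff_outer {n : ℕ} (X Y : Diagram n) (s : Stack n) :
    (X.upper s = s ∨ Y.lower s = s) ↔ ∃ p, outer p = s := by
  rw [upper_fixed, lower_fixed]
  constructor
  · rintro (⟨i, rfl⟩ | ⟨i, rfl⟩)
    · exact ⟨Sum.inr i, rfl⟩
    · exact ⟨Sum.inl i, rfl⟩
  · rintro ⟨i | i, rfl⟩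
    · exact Or.inr ⟨i, rfl⟩
    · exact Or.inl ⟨i, rfl⟩

theorem outer_injective {n : ℕ} : Function.Injective (outer (n := n)) := by
  rintro (i | i) (j | j) h <;> simp_all [outer]

/-- Every top or bottom point of the stack is connected to exactly one other such point. -/
theorem existsUnique_partner {n : ℕ} (X Y : Diagram n) (p : Fin n ⊕ Fin n) :
    ∃! q, q ≠ p ∧ strand X Y (outer p) (outer q) := by
  have hnot : ∀ s, ¬ (X.upper s = s ∧ Y.lower s = s) := by
    intro s
    rw [upper_fixed, lower_fixed]
    rintro ⟨⟨i, rfl⟩, ⟨j, h⟩⟩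
    cases h
  have hends : ∃ w, w ≠ outer p ∧ (X.upper w = w ∨ Y.lower w = w) ∧
      strand X Y (outer p) w ∧
      ∀ u, strand X Y (outer p) u → (X.upper u = u ∨ Y.lower u = u) →
        u = outer p ∨ u = w := by
    rcases (fixed_iff_outer X Y (outer p)).2 ⟨p, rfl⟩ with h | h
    · obtain ⟨w, h1, h2, h3, h4⟩ := exists_end Y.lower X.upper (lower_lower Y) (upper_upper X)
        (fun s hs => hnot s hs.symm) (outer p) h
      have hor : (fun s t => Y.lower s = t ∨ X.upper s = t) =
          fun s t => X.upper s = t ∨ Y.lower s = t := by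
        funext s t; exact propext or_comm
      rw [hor] at h3 h4
      exact ⟨w, h1, h2.symm, h3, fun u hu hf => h4 u hu hf.symm⟩
    · exact exists_end X.upper Y.lower (upper_upper X) (lower_lower Y) hnot (outer p) h
  obtain ⟨w, h1, h2, h3, h4⟩ := hends
  obtain ⟨q, rfl⟩ := (fixed_iff_outer X Y w).1 h2
  refine ⟨q, ⟨fun h => h1 (by rw [h]), h3⟩, ?_⟩
  rintro q' ⟨hq, hs⟩
  rcases h4 (outer q') hs ((fixed_iff_outer X Y _).2 ⟨q', rfl⟩) with h | h
  · exact absurd (outer_injective h) hq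
  · exact outer_injective h

/-- The end of the strand of the stack that starts at the outer point `p`. -/
noncomputable def partner {n : ℕ} (X Y : Diagram n) (p : Fin n ⊕ Fin n) : Fin n ⊕ Fin n :=
  (existsUnique_partner X Y p).choose

theorem partner_spec {n : ℕ} (X Y : Diagram n) (p : Fin n ⊕ Fin n) :
    partner X Y p ≠ p ∧ strand X Y (outer p) (outer (partner X Y p)) :=
  (existsUnique_partner X Y p).choose_spec.1

theorem partner_partner {n : ℕ} (X Y : Diagram n) (p : Fin n ⊕ Fin n) :
    partner X Y (partner X Y p) = p :=
  (existsUnique_partner X Y (partner X Y p)).unique (partner_spec X Y _)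
    ⟨(partner_spec X Y p).1.symm, (strand X Y).symm (partner_spec X Y p).2⟩

/-- The diagram obtained by stacking `X` on top of `Y` and deleting the closed curves. -/
noncomputable def comp {n : ℕ} (X Y : Diagram n) : Diagram n where
  mate := ⟨partner X Y, partner X Y, partner_partner X Y, partner_partner X Y⟩
  mate_mate := partner_partner X Y
  mate_ne p := (partner_spec X Y p).1

/-- The diagram whose strands join the top point `i` to the bottom point `σ i`. -/
def permDiagram {n : ℕ} (σ : Equiv.Perm (Fin n)) : Diagram n where
  mate := ⟨Sum.elim (fun i => Sum.inr (σ i)) (fun i => Sum.inl (σ.symm i)),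
    Sum.elim (fun i => Sum.inr (σ i)) (fun i => Sum.inl (σ.symm i)),
    by rintro (i | i) <;> simp, by rintro (i | i) <;> simp⟩
  mate_mate := by rintro (i | i) <;> simp
  mate_ne := by rintro (i | i) <;> simp

/-- The arc of the diagram `hookDiagram` at a point. -/
def hookMate {n : ℕ} (a b : Fin n) : Fin n ⊕ Fin n → Fin n ⊕ Fin n
  | Sum.inl i => if i = a then Sum.inl b else if i = b then Sum.inl a else Sum.inr i
  | Sum.inr i => if i = a then Sum.inr b else if i = b then Sum.inr a else Sum.inl i

theorem hookMate_hookMate {n : ℕ} (a b : Fin n) (x : Fin n ⊕ Fin n) :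
    hookMate a b (hookMate a b x) = x := by
  rcases x with i | i <;> simp only [hookMate] <;> split_ifs <;> simp_all

/-- The diagram with one arc joining the top points `a`, `b`, one arc joining the bottom points
`a`, `b`, and vertical strands elsewhere. -/
def hookDiagram {n : ℕ} (a b : Fin n) (hab : a ≠ b) : Diagram n where
  mate := ⟨hookMate a b, hookMate a b, hookMate_hookMate a b, hookMate_hookMate a b⟩
  mate_mate := hookMate_hookMate a b
  mate_ne := by
    rintro (i | i) <;> simp only [hookMate, Equiv.coe_fn_mk] <;> split_ifs <;>
      simp_all [eq_comm]

/-- The virtual Temperley-Lieb algebra `VTL_n(d)` over `K`: the free `K`-module on the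
diagrams, with the multiplication below. -/
def VTL (K : Type*) [Field K] (_d : K) (n : ℕ) : Type _ := Diagram n →₀ K

section Algebra

variable {K : Type*} [Field K] {d : K} {n : ℕ}

noncomputable instance : AddCommGroup (VTL K d n) :=
  inferInstanceAs (AddCommGroup (Diagram n →₀ K))

noncomputable instance : Module K (VTL K d n) :=
  inferInstanceAs (Module K (Diagram n →₀ K))

/-- The basis element of `VTL_n(d)` given by a diagram. -/
noncomputable def ofDiagram (D : Diagram n) : VTL K d n := Finsupp.single D (1 : K)

/-- The coefficient of a diagram in an element of `VTL_n(d)`. -/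
def coeff (f : VTL K d n) (D : Diagram n) : K := (show Diagram n →₀ K from f) D

/-- The bilinear multiplication with `X * Y = d ^ loops X Y • comp X Y` on diagrams. -/
noncomputable instance : Mul (VTL K d n) where
  mul f g := Finsupp.sum (show Diagram n →₀ K from f) fun X s =>
    Finsupp.sum (show Diagram n →₀ K from g) fun Y t =>
      (s * t * d ^ loops X Y) • (ofDiagram (comp X Y) : VTL K d n)

/-- The unit `1_n`: the diagram with `n` vertical strands. -/
noncomputable instance : One (VTL K d n) where
  one := ofDiagram (permDiagram 1)

end Algebra

section Projectors

variable {K : Type*} [Field K] (d : K) (n : ℕ)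

/-- The generator `e_i` of `VTL_n(d)`, `1 ≤ i ≤ n - 1` (and `0` for other `i`); the points of a
row are numbered `1, …, n` in the text and `0, …, n - 1` in `Fin n`. -/
noncomputable def e (i : ℕ) : VTL K d n :=
  if h : 1 ≤ i ∧ i < n then
    ofDiagram (hookDiagram ⟨i - 1, by omega⟩ ⟨i, h.2⟩ (by simp [Fin.ext_iff]; omega))
  else 0

/-- The virtual generator `v_i` of `VTL_n(d)`, `1 ≤ i ≤ n - 1` (and `0` for other `i`): the
strands `i` and `i + 1` cross. -/
noncomputable def v (i : ℕ) : VTL K d n :=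
  if h : 1 ≤ i ∧ i < n then
    ofDiagram (permDiagram (Equiv.swap ⟨i - 1, by omega⟩ ⟨i, h.2⟩))
  else 0

/-- `x_i = 1 / (i + 1)`. -/
noncomputable def xCoeff (K : Type*) [Field K] (i : ℕ) : K := 1 / ((i : K) + 1)

/-- `y_i = - 2 i / ((i + 1) (d + 2 i - 2))`. -/
noncomputable def yCoeff (i : ℕ) : K := -(2 * (i : K)) / (((i : K) + 1) * (d + 2 * (i : K) - 2))

/-- `z_i = i / (i + 1)`. -/
noncomputable def zCoeff (K : Type*) [Field K] (i : ℕ) : K := (i : K) / ((i : K) + 1)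

/-- The elements `f_i` of `VTL_n(d)`, for `1 ≤ i ≤ n`: `f_1 = 1_n` and
`f_{i+1} = x_i f_i + y_i f_i e_i f_i + z_i f_i v_i f_i`. The value at `i = 0` is irrelevant. -/
noncomputable def projStep : ℕ → VTL K d n
  | 0 => 1
  | 1 => 1
  | i + 2 =>
    xCoeff K (i + 1) • projStep (i + 1)
      + yCoeff d (i + 1) • (projStep (i + 1) * e d n (i + 1) * projStep (i + 1))
      + zCoeff K (i + 1) • (projStep (i + 1) * v d n (i + 1) * projStep (i + 1))

/-- The projector `f_n` of `VTL_n(d)`. -/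
noncomputable def proj : VTL K d n := projStep d n n

/-- The canonical `k`-element `e_{k+1} e_{k+3} ⋯ e_{n-1}` of `VTL_n(d)`
(for `k < n` with `n - k` even). -/
noncomputable def canonicalElement (k : ℕ) : VTL K d n :=
  ((List.range ((n - k) / 2)).map fun j => e d n (k + 1 + 2 * j)).prod

variable {d n}

/-- `c` is the common coefficient in `f` of the `k`-elements of `VTL_n(d)`, that is, of the
diagrams with exactly `k` through strands. -/
def IsCommonCoeff (f : VTL K d n) (k : ℕ) (c : K) : Prop :=
  (∃ X : Diagram n, X.through = k) ∧ ∀ X : Diagram n, X.through = k → coeff f X = c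

end Projectors

end VirtualTL

namespace VirtualTL

open Equiv (swap)

variable {n : ℕ}

theorem Diagram.mate_injective : Function.Injective (Diagram.mate (n := n)) := by
  intro D E h
  exact Diagram.ext h

theorem Diagram.mate_eq_iff (D : Diagram n) {x y : Fin n ⊕ Fin n} :
    D.mate x = y ↔ D.mate y = x := by
  constructor <;> rintro rfl <;> exact D.mate_mate _

theorem Diagram.ext_mate {D E : Diagram n} (h : ∀ x, D.mate x = E.mate x) : D = E :=
  Diagram.ext (Equiv.ext h)

noncomputable instance : Fintype (Diagram n) := by
  classical exact Fintype.ofInjective _ Diagram.mate_injective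

/-- The diagram obtained by moving the end points of the arcs by a permutation. -/
def Diagram.conj (D : Diagram n) (π : Equiv.Perm (Fin n ⊕ Fin n)) : Diagram n where
  mate := π.symm.trans (D.mate.trans π)
  mate_mate x := by simp [D.mate_mate]
  mate_ne x h := D.mate_ne (π.symm x) (by simpa using π.eq_symm_apply.2 h)

@[simp]
theorem Diagram.conj_mate (D : Diagram n) (π : Equiv.Perm (Fin n ⊕ Fin n)) (x : Fin n ⊕ Fin n) :
    (D.conj π).mate x = π (D.mate (π.symm x)) := rfl

theorem Diagram.conj_conj (D : Diagram n) (π ρ : Equiv.Perm (Fin n ⊕ Fin n)) :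
    (D.conj π).conj ρ = D.conj (ρ * π) := rfl

@[simp]
theorem permDiagram_mate_inl (σ : Equiv.Perm (Fin n)) (i : Fin n) :
    (permDiagram σ).mate (Sum.inl i) = Sum.inr (σ i) := rfl

@[simp]
theorem permDiagram_mate_inr (σ : Equiv.Perm (Fin n)) (i : Fin n) :
    (permDiagram σ).mate (Sum.inr i) = Sum.inl (σ.symm i) := rfl

theorem permDiagram_injective : Function.Injective (permDiagram (n := n)) := by
  intro σ τ h
  ext1 i
  have : (permDiagram σ).mate (Sum.inl i) = (permDiagram τ).mate (Sum.inl i) := by rw [h]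
  simpa using this

theorem hookDiagram_mate {a b : Fin n} (hab : a ≠ b) (x : Fin n ⊕ Fin n) :
    (hookDiagram a b hab).mate x = hookMate a b x := rfl

section Strand

variable (X Y : Diagram n)

theorem strand_upper (s : Stack n) : strand X Y s (X.upper s) :=
  Relation.EqvGen.rel _ _ (Or.inl rfl)

theorem strand_lower (s : Stack n) : strand X Y s (Y.lower s) :=
  Relation.EqvGen.rel _ _ (Or.inr rfl)

theorem strand_inr (q : Fin n ⊕ Fin n) : strand X Y (Sum.inr q) (Sum.inr (Y.mate q)) :=
  strand_lower X Y (Sum.inr q)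

/-- The points of the upper diagram among the points of the stack. -/
def upperPoint : Fin n ⊕ Fin n → Stack n
  | Sum.inl i => Sum.inl i
  | Sum.inr i => Sum.inr (Sum.inl i)

@[simp]
theorem upper_upperPoint (p : Fin n ⊕ Fin n) :
    X.upper (upperPoint p) = upperPoint (X.mate p) := by
  rcases p with i | i <;>
    simp only [Diagram.upper, upperPoint, Equiv.permCongr_apply, Equiv.sumAssoc_symm_apply_inl,
      Equiv.sumAssoc_symm_apply_inr_inl, Equiv.sumCongr_apply, Sum.map_inl]
  · rcases X.mate (Sum.inl i) with j | j <;> rfl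
  · rcases X.mate (Sum.inr i) with j | j <;> rfl

@[simp]
theorem upper_inr_inr (i : Fin n) : X.upper (Sum.inr (Sum.inr i)) = Sum.inr (Sum.inr i) :=
  (upper_fixed X _).2 ⟨i, rfl⟩

theorem strand_upperPoint (p : Fin n ⊕ Fin n) :
    strand X Y (upperPoint p) (upperPoint (X.mate p)) := by
  rw [← upper_upperPoint]; exact strand_upper X Y _

theorem comp_eq_of_strand {X Y Z : Diagram n}
    (h : ∀ p, strand X Y (outer p) (outer (Z.mate p))) : comp X Y = Z := by
  refine Diagram.ext_mate fun p => ?_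
  exact (existsUnique_partner X Y p).unique (partner_spec X Y p) ⟨Z.mate_ne p, h p⟩

theorem strand_comp (p : Fin n ⊕ Fin n) :
    strand X Y (outer p) (outer ((comp X Y).mate p)) := (partner_spec X Y p).2

theorem strand_outer_iff (p q : Fin n ⊕ Fin n) :
    strand X Y (outer p) (outer q) ↔ q = p ∨ q = (comp X Y).mate p := by
  constructor
  · intro h
    by_cases hq : q = p
    · exact Or.inl hq
    · exact Or.inr ((existsUnique_partner X Y p).unique ⟨hq, h⟩ (partner_spec X Y p))
  · rintro (rfl | rfl)
    · exact (strand X Y).refl _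
    · exact strand_comp X Y p

theorem loops_eq_zero {X Y : Diagram n}
    (h : ∀ q, ∃ p, strand X Y (outer p) (Sum.inr q)) : loops X Y = 0 := by
  unfold loops
  rw [Nat.card_eq_zero]
  left
  refine ⟨?_⟩
  rintro ⟨c, hc⟩
  induction c using Quotient.inductionOn with
  | h s =>
    rcases s with i | q
    · exact hc (Sum.inl i) rfl
    · obtain ⟨p, hp⟩ := h q
      exact hc p (Quotient.sound hp)

/-- Invariance of a set of points under both arc systems passes to the strands. -/
theorem strand_mem_iff {X Y : Diagram n} {S : Set (Stack n)}
    (hX : ∀ s ∈ S, X.upper s ∈ S) (hY : ∀ s ∈ S, Y.lower s ∈ S) {s t : Stack n}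
    (h : strand X Y s t) : s ∈ S ↔ t ∈ S := by
  replace h : Relation.EqvGen (fun s t => X.upper s = t ∨ Y.lower s = t) s t := h
  induction h with
  | rel s t h =>
    rcases h with rfl | rfl
    · exact ⟨hX s, fun h => by simpa [upper_upper] using hX _ h⟩
    · exact ⟨hY s, fun h => by simpa [lower_lower] using hY _ h⟩
  | refl s => exact Iff.rfl
  | symm s t _ ih => exact ih.symm
  | trans s t u _ _ ih1 ih2 => exact ih1.trans ih2

end Strand

section PermComp

variable (σ τ : Equiv.Perm (Fin n)) (D : Diagram n)

theorem strand_permDiagram (i : Fin n) :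
    strand (permDiagram σ) D (Sum.inl i) (Sum.inr (Sum.inl (σ i))) :=
  strand_upperPoint (permDiagram σ) D (Sum.inl i)

theorem strand_permDiagram_outer (p : Fin n ⊕ Fin n) :
    strand (permDiagram σ) D (outer p) (Sum.inr (Equiv.sumCongr σ 1 p)) := by
  rcases p with i | i
  · exact strand_permDiagram σ D i
  · exact (strand _ _).refl _

theorem comp_permDiagram_left :
    comp (permDiagram σ) D = D.conj (Equiv.sumCongr σ 1).symm := by
  refine comp_eq_of_strand fun p => ?_
  refine (strand _ _).trans (strand_permDiagram_outer σ D p) ?_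
  refine (strand _ _).trans (strand_inr _ _ _) ?_
  refine (strand _ _).symm ?_
  have := strand_permDiagram_outer σ D ((D.conj (Equiv.sumCongr σ 1).symm).mate p)
  rwa [Diagram.conj_mate, Equiv.apply_symm_apply, Equiv.symm_symm] at this

theorem loops_permDiagram_left : loops (permDiagram σ) D = 0 := by
  refine loops_eq_zero fun q => ⟨(Equiv.sumCongr σ 1).symm q, ?_⟩
  have := strand_permDiagram_outer σ D ((Equiv.sumCongr σ 1).symm q)
  rwa [Equiv.apply_symm_apply] at this

end PermComp

section HookComp

variable {a b : Fin n} (hab : a ≠ b) (D : Diagram n)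

theorem strand_hook_outer {p : Fin n ⊕ Fin n} (ha : p ≠ Sum.inl a) (hb : p ≠ Sum.inl b) :
    strand (hookDiagram a b hab) D (outer p) (Sum.inr p) := by
  rcases p with i | i
  · have := strand_upperPoint (hookDiagram a b hab) D (Sum.inl i)
    rw [hookDiagram_mate] at this
    have h1 : i ≠ a := fun h => ha (by rw [h])
    have h2 : i ≠ b := fun h => hb (by rw [h])
    simpa [hookMate, h1, h2, upperPoint, outer] using this
  · exact (strand _ _).refl _

theorem strand_hook_top :
    strand (hookDiagram a b hab) D (outer (Sum.inl a)) (outer (Sum.inl b)) := by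
  have := strand_upperPoint (hookDiagram a b hab) D (Sum.inl a)
  rw [hookDiagram_mate] at this
  simpa [hookMate, upperPoint, outer] using this

theorem strand_hook_mid :
    strand (hookDiagram a b hab) D (Sum.inr (Sum.inl a)) (Sum.inr (Sum.inl b)) := by
  have := strand_upperPoint (hookDiagram a b hab) D (Sum.inr a)
  rw [hookDiagram_mate] at this
  simpa [hookMate, upperPoint] using this

theorem comp_hookDiagram_left :
    comp (hookDiagram a b hab) D = D.conj (swap (Sum.inl b) (D.mate (Sum.inl a))) := by
  have hne : (Sum.inl a : Fin n ⊕ Fin n) ≠ Sum.inl b := by simpa using hab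
  obtain ⟨x, hx⟩ : ∃ x, x = D.mate (Sum.inl a) := ⟨_, rfl⟩
  have hx' : D.mate x = Sum.inl a := by rw [hx, D.mate_mate]
  have hxa : x ≠ Sum.inl a := by rw [hx]; exact D.mate_ne _
  rw [← hx]
  refine comp_eq_of_strand fun p => ?_
  simp only [Diagram.conj_mate, Equiv.symm_swap]
  by_cases hpa : p = Sum.inl a
  · subst hpa
    rw [Equiv.swap_apply_of_ne_of_ne hne hxa.symm, ← hx, Equiv.swap_apply_right]
    exact strand_hook_top hab D
  by_cases hpb : p = Sum.inl b
  · subst hpb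
    rw [Equiv.swap_apply_left, hx', Equiv.swap_apply_of_ne_of_ne hne hxa.symm]
    exact (strand _ _).symm (strand_hook_top hab D)
  refine (strand _ _).trans (strand_hook_outer hab D hpa hpb) ?_
  by_cases hpx : p = x
  · subst hpx
    rw [Equiv.swap_apply_right]
    have hyb : D.mate (Sum.inl b) ≠ Sum.inl b := D.mate_ne _
    have hyx : D.mate (Sum.inl b) ≠ p := by
      intro h; rw [← h, D.mate_mate] at hx'; exact hne hx'.symm
    have hya : D.mate (Sum.inl b) ≠ Sum.inl a := by
      intro h; rw [← h, D.mate_mate] at hx; exact hpb hx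
    rw [Equiv.swap_apply_of_ne_of_ne hyb hyx]
    refine (strand _ _).trans (strand_inr _ _ _) ?_
    rw [hx']
    refine (strand _ _).trans (strand_hook_mid hab D) ?_
    refine (strand _ _).trans (strand_inr _ _ _) ?_
    exact (strand _ _).symm (strand_hook_outer hab D hya hyb)
  rw [Equiv.swap_apply_of_ne_of_ne hpb hpx]
  refine (strand _ _).trans (strand_inr _ _ _) ?_
  have hqx : D.mate p ≠ x := by
    intro h; rw [hx] at h; exact hpa (D.mate.injective h)
  have hqa : D.mate p ≠ Sum.inl a := by
    intro h; rw [← hx'] at h; exact hpx (D.mate.injective h)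
  by_cases hqb : D.mate p = Sum.inl b
  · rw [hqb, Equiv.swap_apply_left]
    have hxb : x ≠ Sum.inl b := fun h => hqx (by rw [hqb, h])
    refine (strand _ _).trans ((strand _ _).symm (strand_hook_mid hab D)) ?_
    refine (strand _ _).trans (strand_inr _ _ _) ?_
    rw [← hx]
    exact (strand _ _).symm (strand_hook_outer hab D hxa hxb)
  · rw [Equiv.swap_apply_of_ne_of_ne hqb hqx]
    exact (strand _ _).symm (strand_hook_outer hab D hqa hqb)

theorem loops_hookDiagram_of_ne (h : D.mate (Sum.inl a) ≠ Sum.inl b) :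
    loops (hookDiagram a b hab) D = 0 := by
  have ha : strand (hookDiagram a b hab) D (outer (D.mate (Sum.inl a))) (Sum.inr (Sum.inl a)) := by
    refine (strand _ _).trans (strand_hook_outer hab D (D.mate_ne _) h) ?_
    exact (strand _ _).symm (strand_inr _ _ _)
  refine loops_eq_zero fun q => ?_
  by_cases hqa : q = Sum.inl a
  · exact ⟨_, hqa ▸ ha⟩
  by_cases hqb : q = Sum.inl b
  · exact ⟨_, hqb ▸ (strand _ _).trans ha (strand_hook_mid hab D)⟩
  exact ⟨q, strand_hook_outer hab D hqa hqb⟩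

theorem loops_hookDiagram_of_eq (h : D.mate (Sum.inl a) = Sum.inl b) :
    loops (hookDiagram a b hab) D = 1 := by
  have h' : D.mate (Sum.inl b) = Sum.inl a := by rw [← h, D.mate_mate]
  unfold loops
  rw [Nat.card_eq_one_iff_unique]
  constructor
  · have key : ∀ c : {c : Quotient (strand (hookDiagram a b hab) D) //
        ∀ p, Quotient.mk (strand (hookDiagram a b hab) D) (outer p) ≠ c},
        c.1 = Quotient.mk _ (Sum.inr (Sum.inl a)) := by
      rintro ⟨c, hc⟩
      induction c using Quotient.inductionOn with
      | h s =>
        rcases s with i | q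
        · exact absurd rfl (hc (Sum.inl i))
        · by_cases hqa : q = Sum.inl a
          · subst hqa; rfl
          by_cases hqb : q = Sum.inl b
          · subst hqb
            exact Quotient.sound ((strand _ _).symm (strand_hook_mid hab D))
          exact absurd (Quotient.sound (strand_hook_outer hab D hqa hqb)) (hc q)
    exact ⟨fun c c' => Subtype.ext ((key c).trans (key c').symm)⟩
  · refine ⟨⟨Quotient.mk _ (Sum.inr (Sum.inl a)), fun p hp => ?_⟩⟩
    have hs : strand (hookDiagram a b hab) D (outer p) (Sum.inr (Sum.inl a)) := Quotient.exact hp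
    have := (strand_mem_iff (S := {Sum.inr (Sum.inl a), Sum.inr (Sum.inl b)}) ?_ ?_ hs).2 (by simp)
    · rcases p with i | i <;> simp [outer] at this
    · have h1 := upper_upperPoint (hookDiagram a b hab) (Sum.inr a)
      have h2 := upper_upperPoint (hookDiagram a b hab) (Sum.inr b)
      rw [hookDiagram_mate] at h1 h2
      simp only [upperPoint, hookMate, if_true, if_neg hab.symm] at h1 h2
      rintro s (rfl | rfl)
      · rw [h1]; simp
      · rw [h2]; simp
    · rintro s (rfl | rfl)
      · right; simp [Diagram.lower, h]
      · left; simp [Diagram.lower, h']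

end HookComp

end VirtualTL

namespace VirtualTL

open Equiv (swap)

variable {n : ℕ}

section Flip

/-- The reflection of a diagram in a horizontal line. -/
def Diagram.flip (D : Diagram n) : Diagram n := D.conj (Equiv.sumComm _ _)

@[simp]
theorem Diagram.flip_mate (D : Diagram n) (x : Fin n ⊕ Fin n) :
    D.flip.mate x = (D.mate x.swap).swap := rfl

@[simp]
theorem Diagram.flip_flip (D : Diagram n) : D.flip.flip = D :=
  Diagram.ext_mate fun x => by simp

theorem permDiagram_flip (σ : Equiv.Perm (Fin n)) :
    (permDiagram σ).flip = permDiagram σ.symm := by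
  refine Diagram.ext_mate fun x => ?_
  rcases x with i | i <;> simp

theorem hookDiagram_flip {a b : Fin n} (hab : a ≠ b) :
    (hookDiagram a b hab).flip = hookDiagram a b hab := by
  refine Diagram.ext_mate fun x => ?_
  rcases x with i | i <;> simp only [Diagram.flip_mate, hookDiagram_mate, hookMate, Sum.swap_inl,
    Sum.swap_inr] <;> split_ifs <;> rfl

/-- The reflection of the stack of two diagrams. -/
def stackFlip : Stack n → Stack n
  | Sum.inl i => Sum.inr (Sum.inr i)
  | Sum.inr (Sum.inl i) => Sum.inr (Sum.inl i)
  | Sum.inr (Sum.inr i) => Sum.inl i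

@[simp]
theorem stackFlip_stackFlip (s : Stack n) : stackFlip (stackFlip s) = s := by
  rcases s with i | i | i <;> rfl

theorem stackFlip_outer (p : Fin n ⊕ Fin n) : stackFlip (outer p) = outer p.swap := by
  rcases p with i | i <;> rfl

theorem stackFlip_upperPoint (p : Fin n ⊕ Fin n) :
    stackFlip (upperPoint p) = Sum.inr p.swap := by
  rcases p with i | i <;> rfl

theorem stackFlip_upper (X : Diagram n) (s : Stack n) :
    stackFlip (X.upper s) = X.flip.lower (stackFlip s) := by
  have key : ∀ p, stackFlip (X.upper (upperPoint p)) = X.flip.lower (stackFlip (upperPoint p)) := by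
    intro p
    rw [upper_upperPoint, stackFlip_upperPoint, stackFlip_upperPoint]
    simp [Diagram.lower]
  rcases s with i | i | i
  · exact key (Sum.inl i)
  · exact key (Sum.inr i)
  · rw [upper_inr_inr]; rfl

theorem stackFlip_lower (Y : Diagram n) (s : Stack n) :
    stackFlip (Y.lower s) = Y.flip.upper (stackFlip s) := by
  have h := stackFlip_upper Y.flip (stackFlip s)
  rw [Diagram.flip_flip, stackFlip_stackFlip] at h
  rw [← h, stackFlip_stackFlip]

theorem strand_flip_of_strand {X Y : Diagram n} {s t : Stack n} (h : strand X Y s t) :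
    strand Y.flip X.flip (stackFlip s) (stackFlip t) := by
  replace h : Relation.EqvGen (fun s t => X.upper s = t ∨ Y.lower s = t) s t := h
  induction h with
  | rel s t h =>
    rcases h with rfl | rfl
    · rw [stackFlip_upper]; exact strand_lower _ _ _
    · rw [stackFlip_lower]; exact strand_upper _ _ _
  | refl s => exact (strand _ _).refl _
  | symm s t _ ih => exact (strand _ _).symm ih
  | trans s t u _ _ ih1 ih2 => exact (strand _ _).trans ih1 ih2

theorem strand_flip_iff {X Y : Diagram n} {s t : Stack n} :
    strand X Y s t ↔ strand Y.flip X.flip (stackFlip s) (stackFlip t) :=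
  ⟨strand_flip_of_strand, fun h => by
    have h' := strand_flip_of_strand h
    rwa [Diagram.flip_flip, Diagram.flip_flip, stackFlip_stackFlip, stackFlip_stackFlip] at h'⟩

theorem comp_flip (X Y : Diagram n) : comp Y.flip X.flip = (comp X Y).flip := by
  refine comp_eq_of_strand fun p => ?_
  rw [strand_flip_iff, Diagram.flip_flip, Diagram.flip_flip, stackFlip_outer, stackFlip_outer]
  simpa using strand_comp X Y p.swap

theorem loops_flip (X Y : Diagram n) : loops Y.flip X.flip = loops X Y := by
  symm
  let φ : Stack n ≃ Stack n :=
    ⟨stackFlip, stackFlip, stackFlip_stackFlip, stackFlip_stackFlip⟩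
  let ψ : Quotient (strand X Y) ≃ Quotient (strand Y.flip X.flip) :=
    Quotient.congr φ fun s t => strand_flip_iff
  have hψ : ∀ p, ψ (Quotient.mk _ (outer p)) = Quotient.mk _ (outer p.swap) := by
    intro p
    rw [← stackFlip_outer]; rfl
  refine Nat.card_congr (Equiv.subtypeEquiv ψ fun c => ?_)
  constructor
  · intro h p hp
    refine h p.swap (ψ.injective ?_)
    rw [hψ, Sum.swap_swap, hp]
  · intro h p hp
    refine h p.swap ?_
    rw [← hψ, hp]

end Flip

section Colouring

open Classical in
/-- The matrix of a diagram on colourings of the top and bottom points: the entry is `1` if every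
arc is monochromatic and `0` otherwise. -/
noncomputable def colourMatrix (C : Type*) (D : Diagram n) :
    Matrix (Fin n → C) (Fin n → C) ℕ :=
  fun s t => if ∀ x, Sum.elim s t (D.mate x) = Sum.elim s t x then 1 else 0

variable {C : Type*}

theorem colour_eq_of_strand {X Y : Diagram n} {s u t : Fin n → C}
    (hX : ∀ x, Sum.elim s u (X.mate x) = Sum.elim s u x)
    (hY : ∀ x, Sum.elim u t (Y.mate x) = Sum.elim u t x) {x y : Stack n} (h : strand X Y x y) :
    Sum.elim s (Sum.elim u t) x = Sum.elim s (Sum.elim u t) y := by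
  have hup : ∀ p, Sum.elim s (Sum.elim u t) (upperPoint p) = Sum.elim s u p := by
    rintro (i | i) <;> rfl
  have key : ∀ z, Sum.elim s (Sum.elim u t) (X.upper z) = Sum.elim s (Sum.elim u t) z := by
    have : ∀ p, Sum.elim s (Sum.elim u t) (X.upper (upperPoint p)) =
        Sum.elim s (Sum.elim u t) (upperPoint p) := fun p => by
      rw [upper_upperPoint, hup, hup, hX]
    rintro (i | i | i)
    · exact this (Sum.inl i)
    · exact this (Sum.inr i)
    · rw [upper_inr_inr]
  have key' : ∀ z, Sum.elim s (Sum.elim u t) (Y.lower z) = Sum.elim s (Sum.elim u t) z := by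
    rintro (i | p)
    · rfl
    · exact hY p
  exact (strand_mem_iff (X := X) (Y := Y)
    (S := {z | Sum.elim s (Sum.elim u t) z = Sum.elim s (Sum.elim u t) y})
    (fun z hz => (key z).trans hz) (fun z hz => (key' z).trans hz) h).2 rfl

theorem elim_outer (s u t : Fin n → C) (p : Fin n ⊕ Fin n) :
    Sum.elim s (Sum.elim u t) (outer p) = Sum.elim s t p := by
  rcases p with i | i <;> rfl

theorem card_middle_colourings [Finite C] {X Y : Diagram n} {s t : Fin n → C}
    (h : ∀ x, Sum.elim s t ((comp X Y).mate x) = Sum.elim s t x) :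
    Nat.card {u : Fin n → C // (∀ x, Sum.elim s u (X.mate x) = Sum.elim s u x) ∧
      ∀ x, Sum.elim u t (Y.mate x) = Sum.elim u t x} = Nat.card C ^ loops X Y := by
  classical
  unfold loops
  rw [← Nat.card_fun]
  refine Nat.card_congr (Equiv.ofBijective
    (fun u c => Sum.elim s (Sum.elim u.1 t) (Quotient.out c.1)) ⟨?_, ?_⟩)
  · rintro ⟨u, hu1, hu2⟩ ⟨w, hw1, hw2⟩ huw
    ext i
    by_cases hi : ∃ p, strand X Y (outer p) (Sum.inr (Sum.inl i))
    · obtain ⟨p, hp⟩ := hi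
      have h1 := colour_eq_of_strand hu1 hu2 hp
      have h2 := colour_eq_of_strand hw1 hw2 hp
      rw [elim_outer] at h1 h2
      exact h1.symm.trans h2
    · have hc : ∀ p, Quotient.mk (strand X Y) (outer p) ≠
          Quotient.mk (strand X Y) (Sum.inr (Sum.inl i)) := fun p hp =>
        hi ⟨p, Quotient.exact hp⟩
      have h0 := congrFun huw ⟨_, hc⟩
      have hout : strand X Y (Quotient.out (Quotient.mk (strand X Y) (Sum.inr (Sum.inl i))))
        (Sum.inr (Sum.inl i)) := Quotient.mk_out _
      have h1 := colour_eq_of_strand hu1 hu2 hout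
      have h2 := colour_eq_of_strand hw1 hw2 hout
      exact h1.symm.trans (h0.trans h2)
  · intro g
    have hP : ∀ p q, strand X Y (outer p) (outer q) → Sum.elim s t p = Sum.elim s t q := by
      intro p q hpq
      rcases (strand_outer_iff X Y p q).1 hpq with rfl | rfl
      · rfl
      · exact (h p).symm
    let F : Quotient (strand X Y) → C := fun c =>
      if hc : ∃ p, Quotient.mk (strand X Y) (outer p) = c then Sum.elim s t hc.choose
      else g ⟨c, not_exists.1 hc⟩
    have hF : ∀ p, F (Quotient.mk _ (outer p)) = Sum.elim s t p := by
      intro p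
      have hc : ∃ q, Quotient.mk (strand X Y) (outer q) = Quotient.mk (strand X Y) (outer p) :=
        ⟨p, rfl⟩
      simp only [F, dif_pos hc]
      exact hP _ _ (Quotient.exact hc.choose_spec)
    let u : Fin n → C := fun i => F (Quotient.mk _ (Sum.inr (Sum.inl i)))
    have hu : ∀ z, Sum.elim s (Sum.elim u t) z = F (Quotient.mk _ z) := by
      rintro (i | i | i)
      · exact (hF (Sum.inl i)).symm
      · rfl
      · exact (hF (Sum.inr i)).symm
    have hup : ∀ p, Sum.elim s u p = F (Quotient.mk _ (upperPoint p)) := by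
      intro p
      rw [← hu]
      rcases p with i | i <;> rfl
    have hlow : ∀ p, Sum.elim u t p = F (Quotient.mk _ (Sum.inr p)) := fun p => hu (Sum.inr p)
    refine ⟨⟨u, fun x => ?_, fun x => ?_⟩, ?_⟩
    · rw [hup, hup]
      exact congrArg F (Quotient.sound ((strand X Y).symm (strand_upperPoint X Y x)))
    · rw [hlow, hlow]
      exact congrArg F (Quotient.sound ((strand X Y).symm (strand_inr X Y x)))
    · ext ⟨c, hc⟩
      simp only [hu, Quotient.out_eq]
      exact dif_neg (not_exists.2 hc)

theorem colourMatrix_mul [Fintype C] (X Y : Diagram n) :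
    colourMatrix C X * colourMatrix C Y =
      Fintype.card C ^ loops X Y • colourMatrix C (comp X Y) := by
  classical
  ext s t
  rw [Matrix.mul_apply, Matrix.smul_apply]
  simp only [colourMatrix, mul_ite, mul_one, mul_zero, ← ite_and]
  rw [Finset.sum_boole, Nat.cast_id, ← Fintype.card_subtype, ← Nat.card_eq_fintype_card]
  split_ifs with h
  · rw [smul_eq_mul, mul_one, ← Nat.card_eq_fintype_card (α := C), ← card_middle_colourings h]
    exact Nat.card_congr (Equiv.subtypeEquivRight fun u => and_comm)
  · rw [smul_zero, Nat.card_eq_zero]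
    left
    refine ⟨fun ⟨u, hY, hX⟩ => h fun x => ?_⟩
    rw [← elim_outer s u t, ← elim_outer s u t]
    exact (colour_eq_of_strand hX hY (strand_comp X Y x)).symm

theorem exists_colouring_separating (D : Diagram n) :
    ∃ s t : Fin n → Sym2 (Fin n ⊕ Fin n) ⊕ Bool,
      ∀ E : Diagram n, (∀ x, Sum.elim s t (E.mate x) = Sum.elim s t x) ↔ E = D := by
  let c : Fin n ⊕ Fin n → Sym2 (Fin n ⊕ Fin n) ⊕ Bool := fun x => Sum.inl s(x, D.mate x)
  refine ⟨c ∘ Sum.inl, c ∘ Sum.inr, fun E => ?_⟩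
  rw [Sum.elim_comp_inl_inr]
  constructor
  · intro h
    refine Diagram.ext_mate fun x => ?_
    have hx := h x
    simp only [c, Sum.inl.injEq, Sym2.eq_iff] at hx
    rcases hx with ⟨h1, _⟩ | ⟨h1, _⟩
    · exact absurd h1 (E.mate_ne x)
    · exact h1
  · rintro rfl x
    simp only [c, E.mate_mate, Sum.inl.injEq]
    exact Sym2.eq_swap

theorem comp_assoc_and_loops (X Y Z : Diagram n) :
    comp (comp X Y) Z = comp X (comp Y Z) ∧
      loops X Y + loops (comp X Y) Z = loops Y Z + loops X (comp Y Z) := by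
  classical
  let C := Sym2 (Fin n ⊕ Fin n) ⊕ Bool
  have hC : 1 < Fintype.card C := by
    rw [Fintype.card_sum, Fintype.card_bool]; omega
  have key := Matrix.mul_assoc (colourMatrix C X) (colourMatrix C Y) (colourMatrix C Z)
  have hmul := fun X Y : Diagram n => colourMatrix_mul (C := C) X Y
  rw [hmul X Y, hmul Y Z, Matrix.smul_mul, Matrix.mul_smul, hmul, hmul, smul_smul, smul_smul,
    ← pow_add, ← pow_add] at key
  obtain ⟨s, t, hst⟩ := exists_colouring_separating (comp (comp X Y) Z)
  have h := congrFun (congrFun key s) t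
  simp only [Matrix.smul_apply, colourMatrix, hst, if_true] at h
  have h0 : 0 < Fintype.card C := by omega
  by_cases hE : comp X (comp Y Z) = comp (comp X Y) Z
  · refine ⟨hE.symm, ?_⟩
    rw [if_pos hE, smul_eq_mul, smul_eq_mul, mul_one, mul_one] at h
    exact Nat.pow_right_injective hC h
  · rw [if_neg hE, smul_zero, smul_eq_mul, mul_one] at h
    exact absurd h (pow_pos h0 _).ne'

end Colouring

section Algebra

variable {K : Type*} [Field K] {d : K}

theorem VTL.ext {f g : VTL K d n} (h : ∀ D, coeff f D = coeff g D) : f = g := Finsupp.ext h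

@[simp] theorem coeff_add (f g : VTL K d n) (D : Diagram n) :
    coeff (f + g) D = coeff f D + coeff g D := rfl

@[simp] theorem coeff_zero (D : Diagram n) : coeff (0 : VTL K d n) D = 0 := rfl

@[simp] theorem coeff_smul (r : K) (f : VTL K d n) (D : Diagram n) :
    coeff (r • f) D = r * coeff f D := rfl

theorem coeff_sum {ι : Type*} (s : Finset ι) (f : ι → VTL K d n) (D : Diagram n) :
    coeff (∑ i ∈ s, f i) D = ∑ i ∈ s, coeff (f i) D :=
  Finsupp.finsetSum_apply (N := K) s f D

open Classical in
theorem coeff_ofDiagram (X D : Diagram n) :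
    coeff (ofDiagram X : VTL K d n) D = if X = D then 1 else 0 :=
  Finsupp.single_apply

theorem VTL.eq_sum (f : VTL K d n) : f = ∑ D, coeff f D • ofDiagram D := by
  classical
  refine VTL.ext fun E => ?_
  simp [coeff_sum, coeff_ofDiagram]

theorem ofDiagram_mul (X Y : Diagram n) :
    (ofDiagram X * ofDiagram Y : VTL K d n) = d ^ loops X Y • ofDiagram (comp X Y) := by
  refine (Finsupp.sum_single_index ?_).trans ((Finsupp.sum_single_index ?_).trans ?_)
  · simp [Finsupp.sum]
  · simp
  · simp

theorem VTL.mul_add' (f g h : VTL K d n) : f * (g + h) = f * g + f * h := by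
  refine Eq.trans ?_ Finsupp.sum_add
  refine Finsupp.sum_congr fun X _ => ?_
  refine Finsupp.sum_add_index' (fun Y => ?_) (fun Y a b => ?_)
  · simp
  · rw [mul_add, add_mul, add_smul]

theorem VTL.add_mul' (f g h : VTL K d n) : (f + g) * h = f * h + g * h := by
  refine Finsupp.sum_add_index' (fun Y => ?_) (fun Y a b => ?_)
  · simp [Finsupp.sum]
  · refine Eq.trans ?_ Finsupp.sum_add
    refine Finsupp.sum_congr fun X _ => ?_
    rw [add_mul, add_mul, add_smul]

theorem VTL.smul_mul' (r : K) (f g : VTL K d n) : (r • f) * g = r • (f * g) := by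
  refine (Finsupp.sum_smul_index (fun X => ?_)).trans (Eq.trans ?_ Finsupp.smul_sum.symm)
  · simp [Finsupp.sum]
  · refine Finsupp.sum_congr fun X _ => ?_
    refine Eq.trans ?_ Finsupp.smul_sum.symm
    refine Finsupp.sum_congr fun Y _ => ?_
    rw [smul_smul, mul_assoc, mul_assoc, mul_assoc]

theorem VTL.mul_smul' (r : K) (f g : VTL K d n) : f * (r • g) = r • (f * g) := by
  refine Eq.trans ?_ Finsupp.smul_sum.symm
  refine Finsupp.sum_congr fun X _ => ?_
  refine (Finsupp.sum_smul_index (fun X => ?_)).trans (Eq.trans ?_ Finsupp.smul_sum.symm)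
  · simp
  · refine Finsupp.sum_congr fun Y _ => ?_
    rw [smul_smul, mul_left_comm, mul_assoc r]

theorem VTL.induction_linear {p : VTL K d n → Prop} (f : VTL K d n) (h0 : p 0)
    (hadd : ∀ f g, p f → p g → p (f + g)) (hsmul : ∀ (r : K) D, p (r • ofDiagram D)) : p f := by
  rw [VTL.eq_sum f]
  exact Finset.sum_induction _ p hadd h0 fun D _ => hsmul _ _

theorem VTL.zero_mul' (f : VTL K d n) : 0 * f = 0 := by
  simpa using VTL.smul_mul' 0 (0 : VTL K d n) f

theorem VTL.mul_zero' (f : VTL K d n) : f * 0 = 0 := by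
  simpa using VTL.mul_smul' 0 f (0 : VTL K d n)

theorem VTL.mul_assoc' (f g h : VTL K d n) : f * g * h = f * (g * h) := by
  induction f using VTL.induction_linear with
  | h0 => simp only [VTL.zero_mul']
  | hadd f f' hf hf' => simp only [VTL.add_mul', hf, hf']
  | hsmul r X =>
  induction g using VTL.induction_linear with
  | h0 => simp only [VTL.zero_mul', VTL.mul_zero']
  | hadd f f' hf hf' => simp only [VTL.add_mul', VTL.mul_add', hf, hf']
  | hsmul r' Y =>
  induction h using VTL.induction_linear with
  | h0 => simp only [VTL.mul_zero']
  | hadd f f' hf hf' => simp only [VTL.mul_add', hf, hf']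
  | hsmul r'' Z =>
  obtain ⟨h1, h2⟩ := comp_assoc_and_loops X Y Z
  simp only [VTL.smul_mul', VTL.mul_smul', ofDiagram_mul]
  rw [smul_comm (d ^ loops Y Z) r, smul_smul (d ^ loops X Y), smul_smul (d ^ loops Y Z),
    ← pow_add, ← pow_add, h1, h2]

theorem comp_permDiagram_one (D : Diagram n) : comp (permDiagram 1) D = D := by
  have h : Equiv.sumCongr (1 : Equiv.Perm (Fin n)) (1 : Equiv.Perm (Fin n)) = 1 := by
    ext1 x; rcases x with i | i <;> rfl
  rw [comp_permDiagram_left, h]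
  rfl

/-- The linear anti-automorphism of the algebra given by reflection of the diagrams. -/
noncomputable def star (f : VTL K d n) : VTL K d n := ∑ D, coeff f D • ofDiagram D.flip

theorem coeff_star (f : VTL K d n) (D : Diagram n) : coeff (star f) D = coeff f D.flip := by
  classical
  have h : ∀ E : Diagram n, E.flip = D ↔ E = D.flip := fun E =>
    ⟨fun h => by rw [← h, Diagram.flip_flip], fun h => by rw [h, Diagram.flip_flip]⟩
  simp [star, coeff_sum, coeff_ofDiagram, h]

theorem star_add (f g : VTL K d n) : star (f + g) = star f + star g :=
  VTL.ext fun D => by simp [coeff_star]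

theorem star_smul (r : K) (f : VTL K d n) : star (r • f) = r • star f :=
  VTL.ext fun D => by simp [coeff_star]

theorem star_zero : star (0 : VTL K d n) = 0 :=
  VTL.ext fun D => by simp [coeff_star]

theorem star_star (f : VTL K d n) : star (star f) = f :=
  VTL.ext fun D => by simp [coeff_star]

theorem star_ofDiagram (D : Diagram n) : star (ofDiagram D : VTL K d n) = ofDiagram D.flip := by
  classical
  refine VTL.ext fun E => ?_
  rw [coeff_star, coeff_ofDiagram, coeff_ofDiagram]
  congr 1
  exact propext ⟨fun h => by rw [h, Diagram.flip_flip], fun h => by rw [← h, Diagram.flip_flip]⟩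

theorem star_mul (f g : VTL K d n) : star (f * g) = star g * star f := by
  induction f using VTL.induction_linear with
  | h0 => simp only [VTL.zero_mul', VTL.mul_zero', star_zero]
  | hadd f f' hf hf' => simp only [VTL.add_mul', VTL.mul_add', star_add, hf, hf']
  | hsmul r X =>
  induction g using VTL.induction_linear with
  | h0 => simp only [VTL.zero_mul', VTL.mul_zero', star_zero]
  | hadd f f' hf hf' => simp only [VTL.add_mul', VTL.mul_add', star_add, hf, hf']
  | hsmul r' Y =>
  simp only [VTL.smul_mul', VTL.mul_smul', star_smul, ofDiagram_mul, star_ofDiagram, comp_flip,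
    loops_flip]
  rw [smul_comm]

theorem VTL.one_mul' (f : VTL K d n) : 1 * f = f := by
  induction f using VTL.induction_linear with
  | h0 => simp only [VTL.mul_zero']
  | hadd f f' hf hf' => simp only [VTL.mul_add', hf, hf']
  | hsmul r X =>
    rw [VTL.mul_smul']
    congr 1
    refine (ofDiagram_mul _ _).trans ?_
    rw [loops_permDiagram_left, comp_permDiagram_one, pow_zero, one_smul]

theorem star_one : star (1 : VTL K d n) = 1 :=
  (star_ofDiagram _).trans (by rw [permDiagram_flip]; rfl)

theorem VTL.mul_one' (f : VTL K d n) : f * 1 = f := by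
  have h := congrArg star (VTL.one_mul' (star f))
  rwa [star_mul, star_one, star_star] at h

noncomputable instance : Ring (VTL K d n) where
  zero_add := zero_add
  add_zero := add_zero
  nsmul := fun k f => k • f
  zsmul := fun k f => k • f
  nsmul_zero := fun f => zero_nsmul f
  nsmul_succ := fun k f => succ_nsmul f k
  zsmul_zero' := fun f => zero_zsmul f
  zsmul_succ' := fun k f => SubNegMonoid.zsmul_succ' k f
  zsmul_neg' := fun k f => SubNegMonoid.zsmul_neg' k f
  neg_add_cancel := neg_add_cancel
  sub_eq_add_neg := sub_eq_add_neg
  left_distrib := VTL.mul_add'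
  right_distrib := VTL.add_mul'
  zero_mul := VTL.zero_mul'
  mul_zero := VTL.mul_zero'
  mul_assoc := VTL.mul_assoc'
  one_mul := VTL.one_mul'
  mul_one := VTL.mul_one'

instance : IsScalarTower K (VTL K d n) (VTL K d n) := ⟨VTL.smul_mul'⟩

instance : SMulCommClass K (VTL K d n) (VTL K d n) :=
  ⟨fun r f g => (VTL.mul_smul' r f g).symm⟩

end Algebra

end VirtualTL

namespace VirtualTL

open Equiv (swap)

variable {n : ℕ}

section CapCount

/-- The number of top points that are joined to a top point. -/
def Diagram.capCount (D : Diagram n) : ℕ :=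
  (Finset.univ.filter fun i : Fin n => (D.mate (Sum.inl i)).isLeft = true).card

theorem Diagram.capCount_add_through (D : Diagram n) : D.capCount + D.through = n := by
  have h := Finset.card_filter_add_card_filter_not (s := (Finset.univ : Finset (Fin n)))
    (fun i : Fin n => (D.mate (Sum.inl i)).isLeft = true)
  simpa [Diagram.capCount, Diagram.through] using h

theorem Diagram.through_flip (D : Diagram n) : D.flip.through = D.through := by
  have hr : ∀ x : Fin n ⊕ Fin n, x.isRight = true → ∃ j, x = Sum.inr j := by
    rintro (j | j) h
    · simp at h
    · exact ⟨j, rfl⟩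
  have h : ∀ D : Diagram n, D.through ≤ D.flip.through := by
    intro D
    refine Finset.card_le_card_of_injOn (fun i => (D.mate (Sum.inl i)).elim id id) ?_ ?_
    · intro i hi
      simp only [Finset.coe_filter, Finset.mem_univ, true_and, Set.mem_ofPred_eq] at hi ⊢
      obtain ⟨j, hj⟩ := hr _ hi
      simp [hj, (D.mate_eq_iff).1 hj]
    · intro i hi i' hi' hii
      simp only [Finset.coe_filter, Finset.mem_univ, true_and, Set.mem_ofPred_eq] at hi hi'
      obtain ⟨j, hj⟩ := hr _ hi
      obtain ⟨j', hj'⟩ := hr _ hi'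
      simp only [hj, hj', Sum.elim_inr, id] at hii
      subst hii
      exact Sum.inl_injective (D.mate.injective (hj.trans hj'.symm))
  refine le_antisymm ?_ (h D)
  simpa using h D.flip

theorem Diagram.capCount_flip (D : Diagram n) : D.flip.capCount = D.capCount := by
  have h1 := D.capCount_add_through
  have h2 := D.flip.capCount_add_through
  rw [D.through_flip] at h2
  omega

theorem Diagram.card_filter_cup (D : Diagram n) :
    (Finset.univ.filter fun i : Fin n => (D.mate (Sum.inr i)).isRight = true).card =
      D.capCount := by
  rw [← D.capCount_flip]
  simp [Diagram.capCount]

theorem Diagram.capCount_conj_sumCongr (D : Diagram n) (σ : Equiv.Perm (Fin n)) :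
    (D.conj (Equiv.sumCongr σ 1)).capCount = D.capCount := by
  refine Finset.card_equiv σ.symm fun i => ?_
  simp

end CapCount

section Support

/-- All strands of the diagram with index at least `m` are vertical. -/
def Diagram.VerticalFrom (D : Diagram n) (m : ℕ) : Prop :=
  ∀ i : Fin n, m ≤ i → D.mate (Sum.inl i) = Sum.inr i

/-- The permutation fixes all indices at least `m`. -/
def FixesFrom (σ : Equiv.Perm (Fin n)) (m : ℕ) : Prop := ∀ i : Fin n, m ≤ i → σ i = i

theorem FixesFrom.symm {σ : Equiv.Perm (Fin n)} {m : ℕ} (h : FixesFrom σ m) :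
    FixesFrom σ.symm m := fun i hi => by rw [Equiv.symm_apply_eq, h i hi]

theorem FixesFrom.mono {σ : Equiv.Perm (Fin n)} {m m' : ℕ} (h : FixesFrom σ m) (hm : m ≤ m') :
    FixesFrom σ m' := fun i hi => h i (hm.trans hi)

theorem fixesFrom_swap {a b : Fin n} {m : ℕ} (ha : (a : ℕ) < m) (hb : (b : ℕ) < m) :
    FixesFrom (swap a b) m := fun i hi =>
  Equiv.swap_apply_of_ne_of_ne (by rintro rfl; omega) (by rintro rfl; omega)

theorem FixesFrom.apply_lt {σ : Equiv.Perm (Fin n)} {m : ℕ} (h : FixesFrom σ m) {i : Fin n}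
    (hi : (i : ℕ) < m) : (σ i : ℕ) < m := by
  by_contra hc
  have h1 := h _ (not_lt.1 hc)
  have h2 := σ.injective h1
  rw [h2] at hc
  exact hc hi

theorem Diagram.VerticalFrom.mate_inr {D : Diagram n} {m : ℕ} (h : D.VerticalFrom m) (i : Fin n)
    (hi : m ≤ i) : D.mate (Sum.inr i) = Sum.inl i := D.mate_eq_iff.1 (h i hi)

theorem Diagram.VerticalFrom.flip {D : Diagram n} {m : ℕ} (h : D.VerticalFrom m) :
    D.flip.VerticalFrom m := fun i hi => by simp [h.mate_inr i hi]

theorem Diagram.verticalFrom_flip_iff {D : Diagram n} {m : ℕ} :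
    D.flip.VerticalFrom m ↔ D.VerticalFrom m :=
  ⟨fun h => by simpa using h.flip, fun h => h.flip⟩

theorem Diagram.VerticalFrom.conj_sumCongr {D : Diagram n} {m : ℕ} (h : D.VerticalFrom m)
    {σ : Equiv.Perm (Fin n)} (hσ : FixesFrom σ m) :
    (D.conj (Equiv.sumCongr σ 1)).VerticalFrom m := fun i hi => by
  simp [hσ.symm i hi, h i hi]

theorem conj_sumCongr_symm (D : Diagram n) (σ : Equiv.Perm (Fin n)) :
    (D.conj (Equiv.sumCongr σ 1)).conj (Equiv.sumCongr σ.symm 1) = D := by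
  have h : Equiv.sumCongr σ.symm (1 : Equiv.Perm (Fin n)) * Equiv.sumCongr σ 1 = 1 := by
    ext1 x; rcases x with i | i <;> simp
  rw [Diagram.conj_conj, h]; rfl

theorem Diagram.verticalFrom_conj_sumCongr_iff {D : Diagram n} {m : ℕ}
    {σ : Equiv.Perm (Fin n)} (hσ : FixesFrom σ m) :
    (D.conj (Equiv.sumCongr σ 1)).VerticalFrom m ↔ D.VerticalFrom m := by
  refine ⟨fun h => ?_, fun h => h.conj_sumCongr hσ⟩
  have := h.conj_sumCongr hσ.symm
  rwa [conj_sumCongr_symm] at this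

/-- The number of the strand at a point. -/
def strandIndex : Fin n ⊕ Fin n → ℕ := Sum.elim (fun i => i) (fun i => i)

@[simp] theorem strandIndex_inl (i : Fin n) : strandIndex (Sum.inl i) = i := rfl

@[simp] theorem strandIndex_inr (i : Fin n) : strandIndex (Sum.inr i) = i := rfl

theorem Diagram.VerticalFrom.conj_swap {D : Diagram n} {m : ℕ} (h : D.VerticalFrom m) {b : Fin n}
    (hb : (b : ℕ) < m) {x : Fin n ⊕ Fin n} (hx : strandIndex x < m) :
    (D.conj (swap (Sum.inl b) x)).VerticalFrom m := by
  intro j hj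
  have h1 : Sum.inl j ≠ x := by rintro rfl; simp at hx; omega
  have h2 : Sum.inr j ≠ x := by rintro rfl; simp at hx; omega
  have h3 : (Sum.inl j : Fin n ⊕ Fin n) ≠ Sum.inl b := by
    intro h; rw [Sum.inl_injective h] at hj; omega
  rw [Diagram.conj_mate, Equiv.symm_swap, Equiv.swap_apply_of_ne_of_ne h3 h1, h j hj,
    Equiv.swap_apply_of_ne_of_ne (by simp) h2]

theorem Diagram.VerticalFrom.mate_inl_lt {D : Diagram n} {m : ℕ} (h : D.VerticalFrom m)
    {a : Fin n} (ha : (a : ℕ) < m) :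
    strandIndex (D.mate (Sum.inl a)) < m := by
  by_contra hc
  rw [not_lt] at hc
  rcases hx : D.mate (Sum.inl a) with i | i
  · rw [hx] at hc
    have := D.mate_eq_iff.1 hx
    rw [h i hc] at this
    simp at this
  · rw [hx] at hc
    have := D.mate_eq_iff.1 hx
    rw [h.mate_inr i hc] at this
    rw [Sum.inl_injective this] at hc
    simp at hc
    omega

theorem capCount_le_of_verticalFrom {D : Diagram n} {m : ℕ} (hm : m ≤ n) (h : D.VerticalFrom m) :
    D.capCount ≤ m := by
  have hc : (Finset.univ.filter fun i : Fin n => (i : ℕ) < m).card = m := by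
    rw [Fin.card_filter_val_lt, min_eq_right hm]
  refine le_trans (Finset.card_le_card fun i hi => ?_) hc.le
  simp only [Finset.mem_filter, Finset.mem_univ, true_and] at hi ⊢
  by_contra hc
  rw [h i (not_lt.1 hc)] at hi
  simp at hi

end Support

section Surgery

variable {E : Diagram n} {a b : Fin n}

theorem mate_conj_swap (h : E.mate (Sum.inl a) = Sum.inl b) {x : Fin n ⊕ Fin n}
    (hx : x ≠ Sum.inl a) : (E.conj (swap (Sum.inl b) x)).mate (Sum.inl a) = x := by
  have hab : (Sum.inl a : Fin n ⊕ Fin n) ≠ Sum.inl b := fun h' => E.mate_ne _ (h.trans h'.symm)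
  rw [Diagram.conj_mate, Equiv.symm_swap, Equiv.swap_apply_of_ne_of_ne hab hx.symm, h,
    Equiv.swap_apply_left]

theorem conj_swap_conj_swap (D : Diagram n) (x y : Fin n ⊕ Fin n) :
    (D.conj (swap x y)).conj (swap x y) = D := by
  rw [Diagram.conj_conj, Equiv.swap_mul_self]; rfl

theorem capCount_conj_swap_inl (D : Diagram n) (b i : Fin n) :
    (D.conj (swap (Sum.inl b) (Sum.inl i))).capCount = D.capCount := by
  have h : swap (Sum.inl b : Fin n ⊕ Fin n) (Sum.inl i) = Equiv.sumCongr (swap b i) 1 :=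
    (Equiv.Perm.sumCongr_swap_refl b i).symm
  rw [h, Diagram.capCount_conj_sumCongr]

theorem conj_swap_inr_mate (h : E.mate (Sum.inl a) = Sum.inl b) (i j : Fin n) (ha : j ≠ a)
    (hb : j ≠ b) (hi : E.mate (Sum.inr i) ≠ Sum.inl j) :
    (E.conj (swap (Sum.inl b) (Sum.inr i))).mate (Sum.inl j) = E.mate (Sum.inl j) := by
  have h1 : (Sum.inl j : Fin n ⊕ Fin n) ≠ Sum.inl b := fun h => hb (Sum.inl_injective h)
  rw [Diagram.conj_mate, Equiv.symm_swap, Equiv.swap_apply_of_ne_of_ne h1 (by simp),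
    Equiv.swap_apply_of_ne_of_ne]
  · intro h2
    exact ha (Sum.inl_injective (E.mate.injective (h2.trans h.symm)))
  · intro h2
    exact hi (E.mate_eq_iff.1 h2)

theorem conj_swap_inr_mate_self (h : E.mate (Sum.inl a) = Sum.inl b) (i : Fin n) :
    (E.conj (swap (Sum.inl b) (Sum.inr i))).mate (Sum.inl b) = E.mate (Sum.inr i) := by
  rw [Diagram.conj_mate, Equiv.symm_swap, Equiv.swap_apply_left, Equiv.swap_apply_of_ne_of_ne]
  · intro h2
    have := E.mate.injective (h2.trans h.symm)
    simp at this
  · exact E.mate_ne _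

theorem capCount_conj_swap_inr_of_isLeft (h : E.mate (Sum.inl a) = Sum.inl b) (i : Fin n)
    (hi : (E.mate (Sum.inr i)).isLeft = true) :
    (E.conj (swap (Sum.inl b) (Sum.inr i))).capCount = E.capCount := by
  obtain ⟨y, hy⟩ : ∃ y, E.mate (Sum.inr i) = Sum.inl y := by
    rcases hx : E.mate (Sum.inr i) with y | y
    · exact ⟨y, rfl⟩
    · simp [hx] at hi
  have hy' := E.mate_eq_iff.1 hy
  have hb' := E.mate_eq_iff.1 h
  have hab : a ≠ b := by rintro rfl; exact E.mate_ne _ h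
  have hya : y ≠ a := by rintro rfl; rw [h] at hy'; simp at hy'
  have hyb : y ≠ b := by rintro rfl; rw [hb'] at hy'; simp at hy'
  have hEy : (E.conj (swap (Sum.inl b) (Sum.inr i))).mate (Sum.inl y) = Sum.inl b := by
    have h1 : (Sum.inl y : Fin n ⊕ Fin n) ≠ Sum.inl b := by simpa using hyb
    rw [Diagram.conj_mate, Equiv.symm_swap, Equiv.swap_apply_of_ne_of_ne h1 (by simp), hy',
      Equiv.swap_apply_right]
  refine Finset.card_equiv (swap a y) fun j => ?_
  simp only [Finset.mem_filter, Finset.mem_univ, true_and]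
  by_cases hja : j = a
  · subst hja
    rw [mate_conj_swap h (by simp), Equiv.swap_apply_left, hy']
  by_cases hjy : j = y
  · subst hjy
    rw [hEy, Equiv.swap_apply_right, h]
  rw [Equiv.swap_apply_of_ne_of_ne hja hjy]
  by_cases hjb : j = b
  · subst hjb
    rw [conj_swap_inr_mate_self h, hy, hb']; simp
  · rw [conj_swap_inr_mate h i j hja hjb]
    rw [hy]
    exact fun h => hjy (Sum.inl_injective h).symm

theorem capCount_conj_swap_inr_of_isRight (h : E.mate (Sum.inl a) = Sum.inl b) (i : Fin n)
    (hi : (E.mate (Sum.inr i)).isRight = true) :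
    (E.conj (swap (Sum.inl b) (Sum.inr i))).capCount + 2 = E.capCount := by
  have hb' := E.mate_eq_iff.1 h
  have hab : a ≠ b := by rintro rfl; exact E.mate_ne _ h
  have hS : (Finset.univ.filter fun j : Fin n => (E.mate (Sum.inl j)).isLeft = true) =
      insert a (insert b (Finset.univ.filter fun j : Fin n =>
        ((E.conj (swap (Sum.inl b) (Sum.inr i))).mate (Sum.inl j)).isLeft = true)) := by
    ext j
    simp only [Finset.mem_filter, Finset.mem_univ, true_and, Finset.mem_insert]
    by_cases hja : j = a
    · subst hja; simp [h]
    by_cases hjb : j = b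
    · subst hjb; simp [hb']
    rw [conj_swap_inr_mate h i j hja hjb]
    · simp [hja, hjb]
    · intro h'; rw [h'] at hi; simp at hi
  have hbn : b ∉ Finset.univ.filter fun j : Fin n =>
      ((E.conj (swap (Sum.inl b) (Sum.inr i))).mate (Sum.inl j)).isLeft = true := by
    rw [Finset.mem_filter, conj_swap_inr_mate_self h]
    rintro ⟨-, h'⟩
    rcases hx : E.mate (Sum.inr i) with y | y <;> simp [hx] at hi h'
  have han : a ∉ insert b (Finset.univ.filter fun j : Fin n =>
      ((E.conj (swap (Sum.inl b) (Sum.inr i))).mate (Sum.inl j)).isLeft = true) := by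
    rw [Finset.mem_insert, Finset.mem_filter, mate_conj_swap h (by simp)]
    rintro (h' | h')
    · exact hab h'
    · simp at h'
  unfold Diagram.capCount
  rw [hS, Finset.card_insert_of_notMem han, Finset.card_insert_of_notMem hbn]

theorem two_le_capCount (h : E.mate (Sum.inl a) = Sum.inl b) : 2 ≤ E.capCount := by
  have hb' := E.mate_eq_iff.1 h
  have hab : a ≠ b := by rintro rfl; exact E.mate_ne _ h
  rw [← Finset.card_pair hab]
  refine Finset.card_le_card fun j hj => ?_
  simp only [Finset.mem_insert, Finset.mem_singleton] at hj
  rcases hj with rfl | rfl <;> simp [h, hb']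

end Surgery

section Weight

variable {K : Type*} [Field K] (d : K)

/-- The coefficient in the projector on `m` strands of a diagram with `b` top points on caps. -/
noncomputable def weight (m b : ℕ) : K :=
  if Even b then
    ((m.factorial : ℕ) : K)⁻¹ *
      ∏ i ∈ Finset.range (b / 2), -(2 * ((i : K) + 1)) / (d + 2 * (m : K) - 4 - 2 * (i : K))
  else 0

theorem weight_zero (m : ℕ) : weight d m 0 = ((m.factorial : ℕ) : K)⁻¹ := by
  simp [weight]

theorem weight_two_mul (m j : ℕ) : weight d m (2 * j) = ((m.factorial : ℕ) : K)⁻¹ *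
    ∏ i ∈ Finset.range j, -(2 * ((i : K) + 1)) / (d + 2 * (m : K) - 4 - 2 * (i : K)) := by
  simp [weight]

variable {d}

theorem weight_recursion {m b : ℕ} (hd : ∀ j : ℕ, j + 2 ≤ m → d ≠ -(2 * (j : K))) (hb : 2 ≤ b)
    (hbm : b ≤ m) :
    (d + 2 * (m : K) - 2 - (b : K)) * weight d m b + (b : K) * weight d m (b - 2) = 0 := by
  rcases Nat.even_or_odd' b with ⟨j, rfl | rfl⟩
  · obtain ⟨j, rfl⟩ : ∃ i, j = i + 1 := ⟨j - 1, by omega⟩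
    have h2 : 2 * (j + 1) - 2 = 2 * j := by omega
    have hne : d + 2 * (m : K) - 4 - 2 * (j : K) ≠ 0 := by
      obtain ⟨q, hq⟩ : ∃ q, m = j + 2 + q := ⟨m - (j + 2), by omega⟩
      intro h0
      refine hd q (by omega) ?_
      rw [hq] at h0
      push_cast at h0
      linear_combination h0
    rw [h2, weight_two_mul, weight_two_mul, Finset.prod_range_succ]
    push_cast
    field_simp
    ring
  · have h1 : ¬ Even (2 * j + 1) := by simp
    have h2 : ¬ Even (2 * j + 1 - 2) := by
      rw [Nat.not_even_iff_odd]; exact ⟨j - 1, by omega⟩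
    simp only [weight, if_neg h1, if_neg h2, mul_zero, add_zero]

open Classical in
/-- The coefficients of `symProj`. -/
noncomputable def symCoeff (d : K) (m : ℕ) (D : Diagram n) : K :=
  if D.VerticalFrom m then weight d m D.capCount else 0

/-- The element of `VTL_n(d)` supported on the diagrams on the first `m` strands with
coefficients `weight d m`. -/
noncomputable def symProj (d : K) (n m : ℕ) : VTL K d n :=
  ∑ D : Diagram n, symCoeff d m D • ofDiagram D

theorem coeff_symProj (m : ℕ) (D : Diagram n) : coeff (symProj d n m) D = symCoeff d m D := by
  classical
  simp [symProj, coeff_sum, coeff_ofDiagram]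

theorem star_symProj (m : ℕ) : star (symProj d n m) = symProj d n m := by
  refine VTL.ext fun D => ?_
  rw [coeff_star, coeff_symProj, coeff_symProj]
  rw [symCoeff, symCoeff, Diagram.capCount_flip]
  classical exact if_congr Diagram.verticalFrom_flip_iff rfl rfl

theorem ofDiagram_permDiagram_mul (σ : Equiv.Perm (Fin n)) (D : Diagram n) :
    (ofDiagram (permDiagram σ) * ofDiagram D : VTL K d n) =
      ofDiagram (D.conj (Equiv.sumCongr σ.symm 1)) := by
  rw [ofDiagram_mul, loops_permDiagram_left, pow_zero, one_smul, comp_permDiagram_left]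
  rfl

theorem permDiagram_mul_symProj {m : ℕ} {σ : Equiv.Perm (Fin n)} (hσ : FixesFrom σ m) :
    ofDiagram (permDiagram σ) * symProj d n m = symProj d n m := by
  have hc : ∀ D : Diagram n,
      symCoeff d m (D.conj (Equiv.sumCongr σ.symm 1)) = symCoeff d m D := fun D => by
    rw [symCoeff, symCoeff, Diagram.capCount_conj_sumCongr]
    classical exact if_congr (Diagram.verticalFrom_conj_sumCongr_iff hσ.symm) rfl rfl
  unfold symProj
  rw [Finset.mul_sum]
  refine Fintype.sum_equiv
    ⟨fun D => D.conj (Equiv.sumCongr σ.symm 1), fun D => D.conj (Equiv.sumCongr σ 1),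
      fun D => conj_sumCongr_symm D σ.symm, fun D => conj_sumCongr_symm D σ⟩ _ _ fun D => ?_
  rw [mul_smul_comm, ofDiagram_permDiagram_mul]
  simp only [Equiv.coe_fn_mk, hc]

theorem symProj_mul_permDiagram {m : ℕ} {σ : Equiv.Perm (Fin n)} (hσ : FixesFrom σ m) :
    symProj d n m * ofDiagram (permDiagram σ) = symProj d n m := by
  have h := congrArg star (permDiagram_mul_symProj (d := d) hσ.symm)
  rwa [star_mul, star_symProj, star_ofDiagram, permDiagram_flip, Equiv.symm_symm] at h

theorem symCoeff_conj_swap_of_not {m : ℕ} {E : Diagram n} {a b : Fin n}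
    (hE : E.mate (Sum.inl a) = Sum.inl b) (ha : (a : ℕ) < m) (hb : (b : ℕ) < m)
    {x : Fin n ⊕ Fin n} (hx : x ≠ Sum.inl a) (h : ¬ (E.VerticalFrom m ∧ strandIndex x < m)) :
    symCoeff d m (E.conj (swap (Sum.inl b) x)) = 0 := by
  refine if_neg fun hv => h ?_
  have h1 := hv.mate_inl_lt ha
  rw [mate_conj_swap hE hx] at h1
  refine ⟨?_, h1⟩
  have h2 := hv.conj_swap hb h1
  rwa [conj_swap_conj_swap] at h2

theorem sum_symCoeff_conj_swap {m : ℕ} (hd : ∀ j : ℕ, j + 2 ≤ m → d ≠ -(2 * (j : K)))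
    (hm : m ≤ n) {E : Diagram n} {a b : Fin n} (hE : E.mate (Sum.inl a) = Sum.inl b)
    (ha : (a : ℕ) < m) (hb : (b : ℕ) < m) :
    ∑ x ∈ Finset.univ.erase (Sum.inl a : Fin n ⊕ Fin n),
      symCoeff d m (E.conj (swap (Sum.inl b) x)) * (if x = Sum.inl b then d else 1) = 0 := by
  have hab : a ≠ b := by rintro rfl; exact E.mate_ne _ hE
  by_cases hv : E.VerticalFrom m
  swap
  · refine Finset.sum_eq_zero fun x hx => ?_
    rw [symCoeff_conj_swap_of_not hE ha hb (by simpa using hx) (fun h => hv h.1), zero_mul]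
  set T := E.capCount with hT
  set w := weight d m T with hw
  set w' := weight d m (T - 2) with hw'
  have hinl : ∀ i : Fin n, i ≠ a →
      symCoeff d m (E.conj (swap (Sum.inl b) (Sum.inl i))) = if (i : ℕ) < m then w else 0 := by
    intro i hi
    split_ifs with him
    · rw [symCoeff, if_pos (hv.conj_swap hb (x := Sum.inl i) him), capCount_conj_swap_inl]
    · exact symCoeff_conj_swap_of_not hE ha hb (by simpa using hi) (fun h => him h.2)
  have hinr : ∀ i : Fin n,
      symCoeff d m (E.conj (swap (Sum.inl b) (Sum.inr i))) =
        (if (i : ℕ) < m then w else 0) +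
          if (E.mate (Sum.inr i)).isRight = true then w' - w else 0 := by
    intro i
    by_cases him : (i : ℕ) < m
    · rw [symCoeff, if_pos (hv.conj_swap hb (x := Sum.inr i) him), if_pos him]
      split_ifs with hi
      · have := capCount_conj_swap_inr_of_isRight hE i hi
        rw [show (E.conj (swap (Sum.inl b) (Sum.inr i))).capCount = T - 2 by omega]
        ring
      · rw [capCount_conj_swap_inr_of_isLeft hE i (by simpa using hi), add_zero]
    · rw [symCoeff_conj_swap_of_not hE ha hb (x := Sum.inr i) (by simp) (fun h => him h.2), if_neg him,
        hv.mate_inr i (not_lt.1 him)]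
      simp
  have hsplit : ∑ x ∈ Finset.univ.erase (Sum.inl a : Fin n ⊕ Fin n),
      symCoeff d m (E.conj (swap (Sum.inl b) x)) * (if x = Sum.inl b then d else 1) =
      ∑ i : Fin n, ((if (i : ℕ) < m then w else 0) + (if i = a then -w else 0) +
        (if i = b then (d - 1) * w else 0)) +
      ∑ i : Fin n, ((if (i : ℕ) < m then w else 0) +
          if (E.mate (Sum.inr i)).isRight = true then w' - w else 0) := by
    have hite : ∑ x ∈ Finset.univ.erase (Sum.inl a : Fin n ⊕ Fin n),
        symCoeff d m (E.conj (swap (Sum.inl b) x)) * (if x = Sum.inl b then d else 1) =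
        ∑ x : Fin n ⊕ Fin n, if x = Sum.inl a then 0 else
          symCoeff d m (E.conj (swap (Sum.inl b) x)) * (if x = Sum.inl b then d else 1) := by
      symm
      rw [← Finset.add_sum_erase Finset.univ _ (Finset.mem_univ (Sum.inl a)), if_pos rfl, zero_add]
      refine Finset.sum_congr rfl fun x hx => ?_
      rw [if_neg (Finset.ne_of_mem_erase hx)]
    rw [hite, Fintype.sum_sum_type]
    congr 1
    · refine Finset.sum_congr rfl fun i _ => ?_
      by_cases hia : i = a
      · subst hia
        simp [ha, hab]
      · rw [if_neg (by simpa using hia), hinl i hia, if_neg hia]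
        by_cases hib : i = b
        · subst hib
          simp only [hb, if_true]; ring
        · simp [hib]
    · refine Finset.sum_congr rfl fun i _ => ?_
      rw [if_neg (by simp), if_neg (by simp), hinr, mul_one]
  have hcard : ∑ i : Fin n, (if (i : ℕ) < m then w else 0) = (m : K) * w := by
    rw [← Finset.sum_filter, Finset.sum_const, Fin.card_filter_val_lt, min_eq_right hm,
      nsmul_eq_mul]
  have hcup : ∑ i : Fin n, (if (E.mate (Sum.inr i)).isRight = true then w' - w else 0) =
      (T : K) * (w' - w) := by
    rw [← Finset.sum_filter, Finset.sum_const, E.card_filter_cup, nsmul_eq_mul]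
  rw [hsplit, Finset.sum_add_distrib, Finset.sum_add_distrib, Finset.sum_add_distrib, hcard, hcup,
    Finset.sum_ite_eq', Finset.sum_ite_eq', if_pos (Finset.mem_univ _),
    if_pos (Finset.mem_univ _)]
  have hrec := weight_recursion hd (two_le_capCount hE) (capCount_le_of_verticalFrom hm hv)
  linear_combination hrec

theorem hookDiagram_mul_symProj {m : ℕ} (hd : ∀ j : ℕ, j + 2 ≤ m → d ≠ -(2 * (j : K)))
    (hm : m ≤ n) {a b : Fin n} (hab : a ≠ b) (ha : (a : ℕ) < m) (hb : (b : ℕ) < m) :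
    ofDiagram (hookDiagram a b hab) * symProj d n m = 0 := by
  classical
  refine VTL.ext fun E => ?_
  unfold symProj
  simp only [Finset.mul_sum, mul_smul_comm, ofDiagram_mul, coeff_sum, coeff_smul,
    coeff_ofDiagram, comp_hookDiagram_left, coeff_zero]
  by_cases hE : E.mate (Sum.inl a) = Sum.inl b
  swap
  · refine Finset.sum_eq_zero fun D _ => ?_
    rw [if_neg, mul_zero, mul_zero]
    rintro rfl
    refine hE ?_
    rw [Diagram.conj_mate, Equiv.symm_swap, Equiv.swap_apply_of_ne_of_ne (by simpa using hab)
      (D.mate_ne _).symm, Equiv.swap_apply_right]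
  have step : ∑ x ∈ Finset.univ.erase (Sum.inl a : Fin n ⊕ Fin n),
      symCoeff d m (E.conj (swap (Sum.inl b) x)) * (if x = Sum.inl b then d else 1) = 0 := by
    exact sum_symCoeff_conj_swap hd hm hE ha hb
  refine Eq.trans (Eq.symm ?_) step
  refine Finset.sum_of_injOn (fun x => E.conj (swap (Sum.inl b) x)) ?_ (fun x _ => by simp) ?_ ?_
  · intro x hx y hy hxy
    have hx' : x ≠ Sum.inl a := by simpa using hx
    have hy' : y ≠ Sum.inl a := by simpa using hy
    rw [← mate_conj_swap hE hx', ← mate_conj_swap hE hy']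
    exact congrArg (fun D => D.mate (Sum.inl a)) hxy
  · intro D _ hD
    rw [if_neg, mul_zero, mul_zero]
    rintro rfl
    exact hD ⟨D.mate (Sum.inl a), by simpa using D.mate_ne _, conj_swap_conj_swap _ _ _⟩
  · intro x hx
    have hx' : x ≠ Sum.inl a := by simpa using hx
    rw [mate_conj_swap hE hx', conj_swap_conj_swap, if_pos rfl, mul_one]
    congr 1
    split_ifs with hxb
    · rw [loops_hookDiagram_of_eq, pow_one]
      rw [mate_conj_swap hE hx', hxb]
    · rw [loops_hookDiagram_of_ne, pow_zero]
      rwa [mate_conj_swap hE hx']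

theorem symProj_mul_hookDiagram {m : ℕ} (hd : ∀ j : ℕ, j + 2 ≤ m → d ≠ -(2 * (j : K)))
    (hm : m ≤ n) {a b : Fin n} (hab : a ≠ b) (ha : (a : ℕ) < m) (hb : (b : ℕ) < m) :
    symProj d n m * ofDiagram (hookDiagram a b hab) = 0 := by
  have h := congrArg star (hookDiagram_mul_symProj hd hm hab ha hb)
  rwa [star_mul, star_symProj, star_ofDiagram, hookDiagram_flip, star_zero] at h

end Weight

end VirtualTL

namespace VirtualTL

open Equiv (swap)

variable {n : ℕ}

section Shape

theorem exists_permDiagram_of_capCount_eq_zero {D : Diagram n} (h : D.capCount = 0) :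
    ∃ σ, D = permDiagram σ := by
  have hD : ∀ i, ∃ j, D.mate (Sum.inl i) = Sum.inr j := by
    intro i
    rw [Diagram.capCount, Finset.card_eq_zero, Finset.filter_eq_empty_iff] at h
    have := h (Finset.mem_univ i)
    rcases hx : D.mate (Sum.inl i) with j | j
    · simp [hx] at this
    · exact ⟨j, rfl⟩
  choose f hf using hD
  have hinj : Function.Injective f := fun i j hij =>
    Sum.inl_injective (D.mate.injective ((hf i).trans ((congrArg Sum.inr hij).trans (hf j).symm)))
  let σ : Equiv.Perm (Fin n) := Equiv.ofBijective f (Finite.injective_iff_bijective.1 hinj)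
  refine ⟨σ, Diagram.ext_mate fun x => ?_⟩
  rcases x with i | i
  · exact hf i
  · obtain ⟨k, rfl⟩ := σ.surjective i
    rw [permDiagram_mate_inr, Equiv.symm_apply_apply]
    exact D.mate_eq_iff.1 (hf k)

theorem exists_cap {D : Diagram n} (h : D.capCount ≠ 0) :
    ∃ a b, D.mate (Sum.inl a) = Sum.inl b := by
  obtain ⟨a, ha⟩ := Finset.card_ne_zero.1 h
  simp only [Finset.mem_filter, Finset.mem_univ, true_and] at ha
  rcases hx : D.mate (Sum.inl a) with b | b
  · exact ⟨a, b, hx⟩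
  · simp [hx] at ha

theorem exists_cup {D : Diagram n} (h : D.capCount ≠ 0) :
    ∃ a b, D.mate (Sum.inr a) = Sum.inr b := by
  rw [← D.capCount_flip] at h
  obtain ⟨a, b, hab⟩ := exists_cap h
  refine ⟨a, b, ?_⟩
  rw [Diagram.flip_mate] at hab
  rw [← Sum.swap_swap (D.mate (Sum.inr a)), show D.mate (Sum.inr a) = D.mate (Sum.inl a).swap from rfl,
    hab]
  rfl

theorem Diagram.VerticalFrom.lt_of_cap {D : Diagram n} {m : ℕ} (h : D.VerticalFrom m)
    {a b : Fin n} (hab : D.mate (Sum.inl a) = Sum.inl b) : (a : ℕ) < m ∧ (b : ℕ) < m := by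
  constructor
  · by_contra hc
    rw [h a (not_lt.1 hc)] at hab
    simp at hab
  · by_contra hc
    have := D.mate_eq_iff.1 hab
    rw [h b (not_lt.1 hc)] at this
    simp at this

theorem Diagram.VerticalFrom.lt_of_cup {D : Diagram n} {m : ℕ} (h : D.VerticalFrom m)
    {a b : Fin n} (hab : D.mate (Sum.inr a) = Sum.inr b) : (a : ℕ) < m ∧ (b : ℕ) < m :=
  h.flip.lt_of_cap (by simp [hab])

theorem permDiagram_verticalFrom_iff {σ : Equiv.Perm (Fin n)} {m : ℕ} :
    (permDiagram σ).VerticalFrom m ↔ FixesFrom σ m := by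
  simp [Diagram.VerticalFrom, FixesFrom]

theorem permDiagram_capCount (σ : Equiv.Perm (Fin n)) : (permDiagram σ).capCount = 0 := by
  simp [Diagram.capCount]

theorem hookDiagram_capCount {a b : Fin n} (hab : a ≠ b) :
    (hookDiagram a b hab).capCount = 2 := by
  rw [Diagram.capCount, ← Finset.card_pair hab]
  congr 1
  ext i
  rw [Finset.mem_filter, hookDiagram_mate]
  simp only [Finset.mem_univ, true_and, Finset.mem_insert, Finset.mem_singleton, hookMate]
  split_ifs <;> simp_all

theorem hookDiagram_verticalFrom {a b : Fin n} (hab : a ≠ b) {m : ℕ} (ha : (a : ℕ) < m)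
    (hb : (b : ℕ) < m) : (hookDiagram a b hab).VerticalFrom m := by
  intro i hi
  have h1 : i ≠ a := by rintro rfl; omega
  have h2 : i ≠ b := by rintro rfl; omega
  simp [hookDiagram_mate, hookMate, h1, h2]

theorem hookDiagram_conj {a b : Fin n} (hab : a ≠ b) (σ : Equiv.Perm (Fin n)) :
    (hookDiagram a b hab).conj (Equiv.sumCongr σ σ) =
      hookDiagram (σ a) (σ b) (σ.injective.ne hab) := by
  refine Diagram.ext_mate fun x => ?_
  rcases x with i | i <;> obtain ⟨i, rfl⟩ := σ.surjective i <;>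
    simp only [Diagram.conj_mate, hookDiagram_mate, hookMate, Equiv.sumCongr_symm,
      Equiv.sumCongr_apply, Sum.map_inl, Sum.map_inr, Equiv.symm_apply_apply,
      EmbeddingLike.apply_eq_iff_eq] <;> split_ifs <;> rfl

theorem hookDiagram_eq_conj {j l : Fin n} (hjl : j ≠ l) :
    hookDiagram j l hjl = (permDiagram 1).conj (swap (Sum.inl l) (Sum.inr j)) := by
  refine Diagram.ext_mate fun x => ?_
  have h3 : ∀ i, (Equiv.symm (1 : Equiv.Perm (Fin n))) i = i := fun _ => rfl
  rw [Diagram.conj_mate, Equiv.symm_swap, hookDiagram_mate]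
  rcases x with i | i
  · by_cases h1 : i = l
    · subst h1
      rw [Equiv.swap_apply_left, permDiagram_mate_inr, h3]
      simp [hookMate, hjl.symm, Equiv.swap_apply_of_ne_of_ne, hjl]
    · have h1' : (Sum.inl i : Fin n ⊕ Fin n) ≠ Sum.inl l := by simpa using h1
      rw [Equiv.swap_apply_of_ne_of_ne h1' (by simp), permDiagram_mate_inl, Equiv.Perm.one_apply]
      by_cases h2 : i = j
      · subst h2; simp [hookMate]
      · simp [hookMate, h1, h2, Equiv.swap_apply_of_ne_of_ne]
  · by_cases h2 : i = j
    · subst h2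
      rw [Equiv.swap_apply_right, permDiagram_mate_inl, Equiv.Perm.one_apply]
      simp [hookMate, hjl.symm, Equiv.swap_apply_of_ne_of_ne]
    · have h2' : (Sum.inr i : Fin n ⊕ Fin n) ≠ Sum.inr j := by simpa using h2
      rw [Equiv.swap_apply_of_ne_of_ne (by simp) h2', permDiagram_mate_inr]
      rw [h3]
      by_cases h1 : i = l
      · subst h1; simp [hookMate, h2]
      · simp [hookMate, h1, h2, Equiv.swap_apply_of_ne_of_ne]

theorem permDiagram_eq_conj (σ : Equiv.Perm (Fin n)) :
    permDiagram σ = (permDiagram 1).conj (Equiv.sumCongr σ.symm 1) := by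
  refine Diagram.ext_mate fun x => ?_
  rcases x with i | i
  · simp
  · simp only [Diagram.conj_mate, permDiagram_mate_inr]; rfl

theorem permDiagram_conj_swap {j l : Fin n} (hjl : j ≠ l) {τ : Equiv.Perm (Fin n)} (hτ : τ l = l) :
    (permDiagram τ).conj (swap (Sum.inl l) (Sum.inr j)) =
      (hookDiagram j l hjl).conj (Equiv.sumCongr τ.symm 1) := by
  have hτ' : τ.symm l = l := by rw [Equiv.symm_apply_eq, hτ]
  rw [hookDiagram_eq_conj, permDiagram_eq_conj τ, Diagram.conj_conj, Diagram.conj_conj,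
    Equiv.mul_swap_eq_swap_mul]
  simp [hτ']

end Shape

section Absorption

variable {K : Type*} [Field K] {d : K}

theorem symProj_mul_of_cap {m : ℕ} (hd : ∀ j : ℕ, j + 2 ≤ m → d ≠ -(2 * (j : K)))
    (hm : m ≤ n) {D : Diagram n} {a b : Fin n} (h : D.mate (Sum.inl a) = Sum.inl b)
    (ha : (a : ℕ) < m) (hb : (b : ℕ) < m) : symProj d n m * ofDiagram D = 0 := by
  have hab : a ≠ b := by rintro rfl; exact D.mate_ne _ h
  have hab' : (a : ℕ) ≠ b := fun h => hab (Fin.ext h)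
  have hd0 : d ≠ 0 := by simpa using hd 0 (by omega)
  have hD : (ofDiagram D : VTL K d n) = d⁻¹ • (ofDiagram (hookDiagram a b hab) * ofDiagram D) := by
    rw [ofDiagram_mul, loops_hookDiagram_of_eq hab D h, pow_one, smul_smul, inv_mul_cancel₀ hd0,
      one_smul, comp_hookDiagram_left, h, Equiv.swap_self]
    rfl
  rw [hD, mul_smul_comm, ← mul_assoc, symProj_mul_hookDiagram hd hm hab ha hb, zero_mul, smul_zero]

theorem mul_symProj_of_cup {m : ℕ} (hd : ∀ j : ℕ, j + 2 ≤ m → d ≠ -(2 * (j : K)))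
    (hm : m ≤ n) {D : Diagram n} {a b : Fin n} (h : D.mate (Sum.inr a) = Sum.inr b)
    (ha : (a : ℕ) < m) (hb : (b : ℕ) < m) : ofDiagram D * symProj d n m = 0 := by
  have h' : D.flip.mate (Sum.inl a) = Sum.inl b := by simp [h]
  have := congrArg star (symProj_mul_of_cap hd hm h' ha hb)
  rwa [star_mul, star_symProj, star_ofDiagram, Diagram.flip_flip, star_zero] at this

open Classical in
theorem card_fixesFrom {m : ℕ} (hm : m ≤ n) :
    Fintype.card {σ : Equiv.Perm (Fin n) // FixesFrom σ m} = m.factorial := by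
  have e : {σ : Equiv.Perm (Fin n) // FixesFrom σ m} ≃ Equiv.Perm {i : Fin n // (i : ℕ) < m} :=
    (Equiv.subtypeEquivRight fun σ => by simp [FixesFrom]).trans
      (Equiv.Perm.subtypeEquivSubtypePerm fun i : Fin n => (i : ℕ) < m).symm
  rw [Fintype.card_congr e, Fintype.card_perm, Fintype.card_subtype, Fin.card_filter_val_lt,
    min_eq_right hm]

theorem symCoeff_permDiagram {m : ℕ} {σ : Equiv.Perm (Fin n)} (hσ : FixesFrom σ m) :
    symCoeff d m (permDiagram σ) = ((m.factorial : ℕ) : K)⁻¹ := by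
  rw [symCoeff, if_pos (permDiagram_verticalFrom_iff.2 hσ), permDiagram_capCount, weight_zero]

variable [CharZero K]

theorem symProj_mul_symProj {m m' : ℕ} (hd : ∀ j : ℕ, j + 2 ≤ m' → d ≠ -(2 * (j : K)))
    (hmm : m ≤ m') (hm : m' ≤ n) : symProj d n m * symProj d n m' = symProj d n m' := by
  classical
  have h : ∑ _σ : {σ : Equiv.Perm (Fin n) // FixesFrom σ m},
      ((m.factorial : ℕ) : K)⁻¹ • symProj d n m' = symProj d n m * symProj d n m' := by
    conv_rhs => rw [symProj, Finset.sum_mul]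
    refine Fintype.sum_of_injective (fun σ => permDiagram σ.1)
      (fun σ τ h => Subtype.ext (permDiagram_injective h)) _ _ ?_ ?_
    · intro D hD
      rw [smul_mul_assoc]
      by_cases hv : D.VerticalFrom m
      · by_cases hc : D.capCount = 0
        · obtain ⟨σ, rfl⟩ := exists_permDiagram_of_capCount_eq_zero hc
          exact absurd ⟨⟨σ, permDiagram_verticalFrom_iff.1 hv⟩, rfl⟩ hD
        · obtain ⟨a, b, hab⟩ := exists_cup hc
          obtain ⟨ha, hb⟩ := hv.lt_of_cup hab
          rw [mul_symProj_of_cup hd hm hab (ha.trans_le hmm) (hb.trans_le hmm), smul_zero]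
      · rw [symCoeff, if_neg hv, zero_smul]
    · intro σ
      rw [smul_mul_assoc, symCoeff_permDiagram σ.2, permDiagram_mul_symProj (σ.2.mono hmm)]
  have hne : ((m.factorial : ℕ) : K) ≠ 0 := Nat.cast_ne_zero.2 m.factorial_ne_zero
  rw [← h, Finset.sum_const, Finset.card_univ, card_fixesFrom (hmm.trans hm),
    ← Nat.cast_smul_eq_nsmul K, smul_smul, mul_inv_cancel₀ hne, one_smul]

theorem symProj_mul_symProj' {m m' : ℕ} (hd : ∀ j : ℕ, j + 2 ≤ m' → d ≠ -(2 * (j : K)))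
    (hmm : m ≤ m') (hm : m' ≤ n) : symProj d n m' * symProj d n m = symProj d n m' := by
  have h := congrArg star (symProj_mul_symProj hd hmm hm)
  rwa [star_mul, star_symProj, star_symProj] at h

end Absorption

end VirtualTL

namespace VirtualTL

open Equiv (swap)

variable {n : ℕ}

section Sandwich

variable {K : Type*} [Field K] {d : K}

theorem mul_ofDiagram_permDiagram (σ : Equiv.Perm (Fin n)) (D : Diagram n) :
    (ofDiagram D * ofDiagram (permDiagram σ) : VTL K d n) =
      ofDiagram (D.conj (Equiv.sumCongr 1 σ)) := by
  have h := congrArg star (ofDiagram_permDiagram_mul (d := d) σ.symm D.flip)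
  rw [star_mul, star_ofDiagram, star_ofDiagram, star_ofDiagram, Diagram.flip_flip,
    permDiagram_flip, Equiv.symm_symm] at h
  rw [h]
  congr 1
  refine Diagram.ext_mate fun x => ?_
  rcases x with i | i <;> simp only [Diagram.flip_mate, Diagram.conj_mate, Equiv.sumCongr_symm,
      Equiv.sumCongr_apply, Sum.map_inl, Sum.map_inr, Sum.swap_inl, Sum.swap_inr]
  · change (Sum.map σ _ (D.mate (Sum.inl i)).swap).swap = Sum.map _ σ (D.mate (Sum.inl i))
    rcases D.mate (Sum.inl i) with j | j <;> rfl
  · change (Sum.map σ _ (D.mate (Sum.inr (σ.symm i))).swap).swap = Sum.map _ σ (D.mate (Sum.inr (σ.symm i)))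
    rcases D.mate (Sum.inr (σ.symm i)) with j | j <;> rfl

theorem hookDiagram_eq_mul {a b : Fin n} (hab : a ≠ b) (σ : Equiv.Perm (Fin n)) :
    (ofDiagram (hookDiagram (σ a) (σ b) (σ.injective.ne hab)) : VTL K d n) =
      ofDiagram (permDiagram σ.symm) * ofDiagram (hookDiagram a b hab) *
        ofDiagram (permDiagram σ) := by
  rw [ofDiagram_permDiagram_mul, mul_ofDiagram_permDiagram, Diagram.conj_conj, Equiv.symm_symm,
    ← hookDiagram_conj hab σ]
  congr 2
  ext1 x
  rcases x with i | i <;> simp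

theorem permDiagram_mul (σ τ : Equiv.Perm (Fin n)) :
    (ofDiagram (permDiagram σ) * ofDiagram (permDiagram τ) : VTL K d n) =
      ofDiagram (permDiagram (τ * σ)) := by
  rw [ofDiagram_permDiagram_mul]
  congr 1
  refine Diagram.ext_mate fun x => ?_
  rcases x with i | i
  · simp
  · simp; rfl

variable {m : ℕ}

theorem sandwich_hookDiagram {p j l : Fin n} (hj : j ≠ l) (hp : p ≠ l) (hpm : (p : ℕ) < m)
    (hjm : (j : ℕ) < m) (hl : m ≤ l) {τ : Equiv.Perm (Fin n)} (hτ : FixesFrom τ m) :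
    symProj d n m * ofDiagram ((hookDiagram j l hj).conj (Equiv.sumCongr τ.symm 1)) *
      symProj d n m =
      symProj d n m * ofDiagram (hookDiagram p l hp) * symProj d n m := by
  have hs := fixesFrom_swap hpm hjm
  have h1 : hookDiagram j l hj = hookDiagram (swap p j p) (swap p j l)
      ((swap p j).injective.ne hp) := by
    simp only [Equiv.swap_apply_left, hs l hl]
  rw [← ofDiagram_permDiagram_mul, h1, hookDiagram_eq_mul hp (swap p j)]
  simp only [← mul_assoc]
  rw [symProj_mul_permDiagram hτ, symProj_mul_permDiagram hs.symm]
  simp only [mul_assoc]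
  rw [permDiagram_mul_symProj hs]

theorem sandwich_permDiagram {p l : Fin n} (hpm : (p : ℕ) < m) (hl : m = l)
    {σ : Equiv.Perm (Fin n)} (hσ : FixesFrom σ (m + 1)) (hσl : σ l ≠ l) :
    symProj d n m * ofDiagram (permDiagram σ) * symProj d n m =
      symProj d n m * ofDiagram (permDiagram (swap p l)) * symProj d n m := by
  have him : (σ l : ℕ) < m := by
    have h1 := hσ.apply_lt (i := l) (by omega)
    have h2 : (σ l : ℕ) ≠ l := fun h => hσl (Fin.ext h)
    omega
  have hs := fixesFrom_swap him hpm
  have hpl : p ≠ l := by rintro rfl; omega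
  have hτ : FixesFrom (swap (σ l) l * σ) m := by
    intro k hk
    rcases hk.eq_or_lt with h | h
    · have : k = l := Fin.ext (by omega)
      subst this
      simp
    · have hkl : k ≠ l := by rintro rfl; omega
      have hki : k ≠ σ l := by rintro h; rw [h] at hk; omega
      rw [Equiv.Perm.mul_apply, hσ k h, Equiv.swap_apply_of_ne_of_ne hki hkl]
  have h1 : σ = swap (σ l) p * swap p l * swap (σ l) p * (swap (σ l) l * σ) := by
    have h2 : swap (σ l) p * swap p l * swap (σ l) p = swap (σ l) l := by
      rw [Equiv.swap_comm (σ l) p, Equiv.swap_comm p l,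
        Equiv.swap_mul_swap_mul_swap hpl.symm hσl.symm]
    rw [h2, ← mul_assoc, Equiv.swap_mul_self, one_mul]
  generalize swap (σ l) l * σ = τ at h1 hτ
  rw [h1, ← permDiagram_mul, ← permDiagram_mul, ← permDiagram_mul]
  simp only [← mul_assoc]
  rw [symProj_mul_permDiagram hτ, symProj_mul_permDiagram hs]
  simp only [mul_assoc]
  rw [permDiagram_mul_symProj hs]

/-- A diagram on `m + 1` strands with caps, but without arcs among the first `m` top or the first
`m` bottom points, is a translate of a hook. -/
theorem eq_hookDiagram_conj {D : Diagram n} {l : Fin n} (hl : m = l)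
    (hv : D.VerticalFrom (m + 1)) (hc : D.capCount ≠ 0)
    (hcap : ∀ a b : Fin n, (a : ℕ) < m → (b : ℕ) < m → D.mate (Sum.inl a) ≠ Sum.inl b)
    (hcup : ∀ a b : Fin n, (a : ℕ) < m → (b : ℕ) < m → D.mate (Sum.inr a) ≠ Sum.inr b) :
    ∃ (j : Fin n) (hj : j ≠ l) (τ : Equiv.Perm (Fin n)), (j : ℕ) < m ∧ FixesFrom τ m ∧
      (hookDiagram j l hj).conj (Equiv.sumCongr τ.symm 1) = D := by
  have hlt : ∀ k : Fin n, (k : ℕ) < m + 1 → k ≠ l → (k : ℕ) < m := by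
    intro k hk hkl
    have : (k : ℕ) ≠ l := fun h => hkl (Fin.ext h)
    omega
  obtain ⟨i, hi⟩ : ∃ i, D.mate (Sum.inl l) = Sum.inl i := by
    obtain ⟨a, b, hab⟩ := exists_cap hc
    obtain ⟨ha, hb⟩ := hv.lt_of_cap hab
    by_cases hal : a = l
    · exact ⟨b, hal ▸ hab⟩
    by_cases hbl : b = l
    · exact ⟨a, hbl ▸ D.mate_eq_iff.1 hab⟩
    exact absurd hab (hcap a b (hlt a ha hal) (hlt b hb hbl))
  obtain ⟨j, hj⟩ : ∃ j, D.mate (Sum.inr l) = Sum.inr j := by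
    obtain ⟨a, b, hab⟩ := exists_cup hc
    obtain ⟨ha, hb⟩ := hv.lt_of_cup hab
    by_cases hal : a = l
    · exact ⟨b, hal ▸ hab⟩
    by_cases hbl : b = l
    · exact ⟨a, hbl ▸ D.mate_eq_iff.1 hab⟩
    exact absurd hab (hcup a b (hlt a ha hal) (hlt b hb hbl))
  have hjl : j ≠ l := by rintro rfl; exact D.mate_ne _ hj
  have hil : i ≠ l := by rintro rfl; exact D.mate_ne _ hi
  have hjm := hlt j (hv.lt_of_cup hj).2 hjl
  have hj' := D.mate_eq_iff.1 hj
  have hi' := D.mate_eq_iff.1 hi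
  set S := swap (Sum.inl l : Fin n ⊕ Fin n) (Sum.inr j) with hS
  have hSr : ∀ k, k ≠ j → S (Sum.inr k) = Sum.inr k := fun k hk =>
    Equiv.swap_apply_of_ne_of_ne (by simp) (by simpa using hk)
  have hSl : ∀ k, k ≠ l → S (Sum.inl k) = Sum.inl k := fun k hk =>
    Equiv.swap_apply_of_ne_of_ne (by simpa using hk) (by simp)
  have hl0 : (D.conj S).mate (Sum.inl l) = Sum.inr l := by
    rw [Diagram.conj_mate, hS, Equiv.symm_swap, Equiv.swap_apply_left, hj', ← hS, hSr l hjl.symm]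
  have hD' : (D.conj S).capCount = 0 := by
    rw [Diagram.capCount, Finset.card_eq_zero, Finset.filter_eq_empty_iff]
    intro k _
    by_cases hkl : k = l
    · rw [hkl, hl0]; simp
    rw [Diagram.conj_mate, hS, Equiv.symm_swap, ← hS, hSl k hkl]
    by_cases hki : k = i
    · rw [hki, hi', hS, Equiv.swap_apply_left]; simp
    rcases hx : D.mate (Sum.inl k) with y | y
    · exfalso
      have hyl : y ≠ l := by
        rintro rfl
        have := D.mate_eq_iff.1 hx
        rw [hi] at this
        exact hki (Sum.inl_injective this).symm
      obtain ⟨h1, h2⟩ := hv.lt_of_cap hx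
      exact hcap k y (hlt k h1 hkl) (hlt y h2 hyl) hx
    · have hyj : y ≠ j := by
        rintro rfl
        have := D.mate_eq_iff.1 hx
        rw [hj'] at this
        simp at this
      rw [hSr y hyj]; simp
  obtain ⟨τ, hτ⟩ := exists_permDiagram_of_capCount_eq_zero hD'
  have hτl : τ l = l := by
    rw [hτ, permDiagram_mate_inl] at hl0
    exact Sum.inr_injective hl0
  refine ⟨j, hjl, τ, hjm, ?_, ?_⟩
  · intro k hk
    by_cases hkl : k = l
    · rw [hkl, hτl]
    have hkj : k ≠ j := by rintro rfl; omega
    have hk1 : m + 1 ≤ k := by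
      have : (k : ℕ) ≠ l := fun h => hkl (Fin.ext h)
      omega
    have h1 : (D.conj S).mate (Sum.inl k) = Sum.inr k := by
      rw [Diagram.conj_mate, hS, Equiv.symm_swap, ← hS, hSl k hkl, hv k hk1, hSr k hkj]
    rw [hτ, permDiagram_mate_inl] at h1
    exact Sum.inr_injective h1
  · rw [← permDiagram_conj_swap hjl hτl, ← hτ, hS, conj_swap_conj_swap]

theorem hookDiagram_conj_mate_inr_self {j l : Fin n} (hj : j ≠ l) (τ : Equiv.Perm (Fin n)) :
    ((hookDiagram j l hj).conj (Equiv.sumCongr τ.symm 1)).mate (Sum.inr l) = Sum.inr j := by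
  have h1 : (Equiv.sumCongr τ.symm (1 : Equiv.Perm (Fin n))).symm (Sum.inr l) = Sum.inr l := rfl
  rw [Diagram.conj_mate, h1, hookDiagram_mate]
  simp [hookMate, hj.symm]

theorem hookDiagram_conj_injective {j l : Fin n} (hj : j ≠ l) {τ τ' : Equiv.Perm (Fin n)}
    (hτ : τ l = l) (hτ' : τ' l = l)
    (h : (hookDiagram j l hj).conj (Equiv.sumCongr τ.symm 1) =
      (hookDiagram j l hj).conj (Equiv.sumCongr τ'.symm 1)) : τ = τ' := by
  rw [← permDiagram_conj_swap hj hτ, ← permDiagram_conj_swap hj hτ'] at h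
  have h2 := congrArg (fun D => D.conj (swap (Sum.inl l) (Sum.inr j))) h
  simp only [conj_swap_conj_swap] at h2
  exact permDiagram_injective h2

open Classical in
theorem sum_sandwich_permDiagram {p l : Fin n} (hpm : (p : ℕ) < m) (hl : m = l)
    (hF : symProj d n m * symProj d n m = symProj d n m) :
    ∑ σ : {σ : Equiv.Perm (Fin n) // FixesFrom σ (m + 1)},
        symProj d n m * ofDiagram (permDiagram σ.1) * symProj d n m =
      (m.factorial : K) • symProj d n m + ((m * m.factorial : ℕ) : K) •
        (symProj d n m * ofDiagram (permDiagram (swap p l)) * symProj d n m) := by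
  have hfix : ∀ σ : Equiv.Perm (Fin n), (FixesFrom σ (m + 1) ∧ σ l = l) ↔ FixesFrom σ m := by
    refine fun σ => ⟨fun h k hk => ?_, fun h => ⟨h.mono (Nat.le_succ m), h l hl.le⟩⟩
    rcases hk.eq_or_lt with h' | h'
    · have : k = l := Fin.ext (by omega)
      rw [this, h.2]
    · exact h.1 k h'
  have hterm : ∀ σ : {σ : Equiv.Perm (Fin n) // FixesFrom σ (m + 1)},
      symProj d n m * ofDiagram (permDiagram σ.1) * symProj d n m =
        if σ.1 l = l then symProj d n m else
          symProj d n m * ofDiagram (permDiagram (swap p l)) * symProj d n m := by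
    intro σ
    split_ifs with h
    · rw [symProj_mul_permDiagram ((hfix σ.1).1 ⟨σ.2, h⟩), hF]
    · exact sandwich_permDiagram hpm hl σ.2 h
  have hln := l.2
  have hcard : (Finset.univ.filter fun σ : {σ : Equiv.Perm (Fin n) // FixesFrom σ (m + 1)} =>
      σ.1 l = l).card = m.factorial := by
    rw [← Fintype.card_subtype, ← card_fixesFrom (n := n) (m := m) (by omega)]
    exact Fintype.card_congr ((Equiv.subtypeSubtypeEquivSubtypeInter _
      fun σ : Equiv.Perm (Fin n) => σ l = l).trans
      (Equiv.subtypeEquivRight hfix))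
  have hcard' : (Finset.univ.filter fun σ : {σ : Equiv.Perm (Fin n) // FixesFrom σ (m + 1)} =>
      ¬ σ.1 l = l).card = m * m.factorial := by
    have h1 := Finset.card_filter_add_card_filter_not
      (s := (Finset.univ : Finset {σ : Equiv.Perm (Fin n) // FixesFrom σ (m + 1)}))
      (fun σ => σ.1 l = l)
    rw [hcard, Finset.card_univ, card_fixesFrom (n := n) (by omega), Nat.factorial_succ] at h1
    linarith
  rw [Finset.sum_congr rfl fun σ _ => hterm σ, Finset.sum_ite, Finset.sum_const, Finset.sum_const,
    hcard, hcard', Nat.cast_smul_eq_nsmul, Nat.cast_smul_eq_nsmul]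

theorem symProj_sandwich (hd : ∀ j : ℕ, j + 2 ≤ m + 1 → d ≠ -(2 * (j : K)))
    {p l : Fin n} (hpm : (p : ℕ) < m) (hl : m = l) (hp : p ≠ l)
    (hF : symProj d n m * symProj d n m = symProj d n m) :
    symProj d n m * symProj d n (m + 1) * symProj d n m =
      ((m + 1).factorial : K)⁻¹ • ((m.factorial : K) • symProj d n m +
        ((m * m.factorial : ℕ) : K) •
          (symProj d n m * ofDiagram (permDiagram (swap p l)) * symProj d n m)) +
      (((m * m.factorial : ℕ) : K) * weight d (m + 1) 2) •
        (symProj d n m * ofDiagram (hookDiagram p l hp) * symProj d n m) := by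
  classical
  have hln := l.2
  have hjl : ∀ j : {j : Fin n // (j : ℕ) < m}, j.1 ≠ l := fun j h => by
    have := j.2; rw [h] at this; omega
  let e : {σ : Equiv.Perm (Fin n) // FixesFrom σ (m + 1)} ⊕
      ({j : Fin n // (j : ℕ) < m} × {σ : Equiv.Perm (Fin n) // FixesFrom σ m}) → Diagram n :=
    Sum.elim (fun σ => permDiagram σ.1)
      (fun x => (hookDiagram x.1.1 l (hjl x.1)).conj (Equiv.sumCongr x.2.1.symm 1))
  have he : Function.Injective e := by
    rintro (σ | ⟨j, τ⟩) (σ' | ⟨j', τ'⟩) h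
    · exact congrArg Sum.inl (Subtype.ext (permDiagram_injective h))
    · have := congrArg (fun D => D.mate (Sum.inr l)) h
      simp only [e, Sum.elim_inl, Sum.elim_inr, hookDiagram_conj_mate_inr_self,
        permDiagram_mate_inr, reduceCtorEq] at this
    · have := congrArg (fun D => D.mate (Sum.inr l)) h
      simp only [e, Sum.elim_inl, Sum.elim_inr, hookDiagram_conj_mate_inr_self,
        permDiagram_mate_inr, reduceCtorEq] at this
    · have := congrArg (fun D => D.mate (Sum.inr l)) h
      simp only [e, Sum.elim_inr, hookDiagram_conj_mate_inr_self, Sum.inr.injEq] at this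
      have hjj : j = j' := Subtype.ext this
      subst hjj
      have := hookDiagram_conj_injective (hjl j) (τ.2 l hl.le) (τ'.2 l hl.le) h
      rw [Subtype.ext this]
  have key := Fintype.sum_of_injective e he
    (fun x => symCoeff d (m + 1) (e x) • (symProj d n m * ofDiagram (e x) * symProj d n m))
    (fun D => symCoeff d (m + 1) D • (symProj d n m * ofDiagram D * symProj d n m)) ?_
    (fun _ => rfl)
  · have hsum : symProj d n m * symProj d n (m + 1) * symProj d n m =
        ∑ D, symCoeff d (m + 1) D • (symProj d n m * ofDiagram D * symProj d n m) := by
      rw [symProj.eq_1 d n (m + 1), Finset.mul_sum, Finset.sum_mul]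
      refine Finset.sum_congr rfl fun D _ => ?_
      rw [mul_smul_comm, smul_mul_assoc]
    rw [hsum, ← key, Fintype.sum_sum_type]
    congr 1
    · rw [← sum_sandwich_permDiagram hpm hl hF, Finset.smul_sum]
      refine Finset.sum_congr rfl fun σ _ => ?_
      simp only [e, Sum.elim_inl, symCoeff_permDiagram σ.2]
    · have hterm : ∀ x : {j : Fin n // (j : ℕ) < m} × {σ : Equiv.Perm (Fin n) // FixesFrom σ m},
          symCoeff d (m + 1) (e (Sum.inr x)) •
            (symProj d n m * ofDiagram (e (Sum.inr x)) * symProj d n m) =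
          weight d (m + 1) 2 •
            (symProj d n m * ofDiagram (hookDiagram p l hp) * symProj d n m) := by
        rintro ⟨⟨j, hj⟩, ⟨τ, hτ⟩⟩
        simp only [e, Sum.elim_inr]
        have hjl' : j ≠ l := hjl ⟨j, hj⟩
        have hv : ((hookDiagram j l hjl').conj (Equiv.sumCongr τ.symm 1)).VerticalFrom (m + 1) :=
          (hookDiagram_verticalFrom hjl' (by omega) (by omega)).conj_sumCongr
            (hτ.mono (Nat.le_succ m)).symm
        rw [sandwich_hookDiagram hjl' hp hpm hj hl.le hτ, symCoeff, if_pos hv,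
          Diagram.capCount_conj_sumCongr, hookDiagram_capCount]
      rw [Finset.sum_congr rfl fun x _ => hterm x, Finset.sum_const, Finset.card_univ,
        Fintype.card_prod, card_fixesFrom (by omega), Fintype.card_subtype,
        Fin.card_filter_val_lt, min_eq_right (by omega), ← Nat.cast_smul_eq_nsmul K, smul_smul]
  · intro D hD
    have hd' : ∀ j : ℕ, j + 2 ≤ m → d ≠ -(2 * (j : K)) := fun j hj => hd j (by omega)
    by_cases hv : D.VerticalFrom (m + 1)
    swap
    · rw [symCoeff, if_neg hv, zero_smul]
    by_cases hc : D.capCount = 0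
    · obtain ⟨σ, rfl⟩ := exists_permDiagram_of_capCount_eq_zero hc
      exact absurd ⟨Sum.inl ⟨σ, permDiagram_verticalFrom_iff.1 hv⟩, rfl⟩ hD
    by_cases hcap : ∃ a b : Fin n, (a : ℕ) < m ∧ (b : ℕ) < m ∧ D.mate (Sum.inl a) = Sum.inl b
    · obtain ⟨a, b, ha, hb, hab⟩ := hcap
      rw [symProj_mul_of_cap hd' (by omega) hab ha hb, zero_mul, smul_zero]
    by_cases hcup : ∃ a b : Fin n, (a : ℕ) < m ∧ (b : ℕ) < m ∧ D.mate (Sum.inr a) = Sum.inr b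
    · obtain ⟨a, b, ha, hb, hab⟩ := hcup
      rw [mul_assoc, mul_symProj_of_cup hd' (by omega) hab ha hb, mul_zero, smul_zero]
    obtain ⟨j, hj, τ, hjm, hτ, hD'⟩ := eq_hookDiagram_conj hl hv hc
      (fun a b ha hb h => hcap ⟨a, b, ha, hb, h⟩) (fun a b ha hb h => hcup ⟨a, b, ha, hb, h⟩)
    exact absurd ⟨Sum.inr (⟨j, hjm⟩, ⟨τ, hτ⟩), hD'⟩ hD

end Sandwich

end VirtualTL

namespace VirtualTL

open Equiv (swap)

variable {n : ℕ}

section Main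

variable {K : Type*} [Field K] {d : K}

theorem symProj_succ [CharZero K] {m : ℕ} (hd : ∀ j : ℕ, j + 2 ≤ m + 1 → d ≠ -(2 * (j : K)))
    {p l : Fin n} (hpm : (p : ℕ) < m) (hl : m = l) (hp : p ≠ l) :
    symProj d n (m + 1) = xCoeff K m • symProj d n m +
      yCoeff d m • (symProj d n m * ofDiagram (hookDiagram p l hp) * symProj d n m) +
      zCoeff K m • (symProj d n m * ofDiagram (permDiagram (swap p l)) * symProj d n m) := by
  have hln := l.2
  have hd' : ∀ j : ℕ, j + 2 ≤ m → d ≠ -(2 * (j : K)) := fun j hj => hd j (by omega)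
  have hF : symProj d n m * symProj d n m = symProj d n m :=
    symProj_mul_symProj hd' le_rfl (by omega)
  have h := symProj_sandwich hd hpm hl hp hF
  rw [symProj_mul_symProj hd (Nat.le_succ m) (by omega),
    symProj_mul_symProj' hd (Nat.le_succ m) (by omega)] at h
  have hm1 : ((m : K) + 1) ≠ 0 := by exact_mod_cast Nat.succ_ne_zero m
  have hfac : ((m.factorial : ℕ) : K) ≠ 0 := Nat.cast_ne_zero.2 m.factorial_ne_zero
  have hden : d + 2 * (m : K) - 2 ≠ 0 := by
    intro h0
    refine hd (m - 1) (by omega) ?_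
    rw [Nat.cast_sub (by omega), Nat.cast_one]
    linear_combination h0
  have hx : ((m + 1).factorial : K)⁻¹ * (m.factorial : K) = xCoeff K m := by
    rw [xCoeff, Nat.factorial_succ]
    push_cast
    field_simp
  have hz : ((m + 1).factorial : K)⁻¹ * ((m * m.factorial : ℕ) : K) = zCoeff K m := by
    rw [zCoeff, Nat.factorial_succ]
    push_cast
    field_simp
  have hy : ((m * m.factorial : ℕ) : K) * weight d (m + 1) 2 = yCoeff d m := by
    have hden' : d + 2 * ((m : K) + 1) - 4 - 2 * 0 ≠ 0 := by
      intro h0; apply hden; linear_combination h0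
    rw [yCoeff, show (2 : ℕ) = 2 * 1 from rfl, weight_two_mul, Finset.prod_range_one,
      Nat.factorial_succ]
    push_cast
    field_simp
    ring
  rw [h, smul_add, smul_smul, smul_smul, hx, hy, hz]
  abel

theorem symProj_one [CharZero K] : symProj d n 1 = 1 := by
  classical
  refine VTL.ext fun D => ?_
  have h1 : coeff (1 : VTL K d n) D = if permDiagram 1 = D then 1 else 0 := coeff_ofDiagram _ _
  rw [coeff_symProj, h1]
  split_ifs with h
  · subst h
    rw [symCoeff_permDiagram (fun _ _ => rfl)]
    simp
  · rw [symCoeff, if_neg]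
    intro hv
    apply h
    have hc : D.capCount = 0 := by
      by_contra hc
      obtain ⟨a, b, hab⟩ := exists_cap hc
      obtain ⟨ha, hb⟩ := hv.lt_of_cap hab
      have : a = b := Fin.ext (by omega)
      subst this
      exact D.mate_ne _ hab
    obtain ⟨σ, rfl⟩ := exists_permDiagram_of_capCount_eq_zero hc
    have hσ := permDiagram_verticalFrom_iff.1 hv
    congr 1
    symm
    ext1 i
    by_cases hi : 1 ≤ (i : ℕ)
    · exact hσ i hi
    · have := hσ.apply_lt (i := i) (by omega)
      exact Fin.ext (by simp only [Equiv.Perm.one_apply]; omega)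

theorem projStep_eq_symProj [CharZero K] {m : ℕ} (hm : 1 ≤ m) (hmn : m ≤ n)
    (hd : ∀ j : ℕ, j + 2 ≤ m → d ≠ -(2 * (j : K))) : projStep d n m = symProj d n m := by
  induction m, hm using Nat.le_induction with
  | base => exact symProj_one.symm
  | succ m hm ih =>
    obtain ⟨i, rfl⟩ : ∃ i, m = i + 1 := ⟨m - 1, by omega⟩
    have hi : 1 ≤ i + 1 ∧ i + 1 < n := ⟨hm, hmn⟩
    have hpl : (⟨i, by omega⟩ : Fin n) ≠ ⟨i + 1, hmn⟩ := by simp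
    rw [projStep, ih (by omega) fun j hj => hd j (by omega), e, v, dif_pos hi, dif_pos hi,
      symProj_succ hd (p := ⟨i, by omega⟩) (l := ⟨i + 1, hmn⟩) (Nat.lt_succ_self i) rfl hpl]
    rfl

theorem coeff_proj [CharZero K] (hn : 1 ≤ n) (hd : ∀ j : ℕ, j + 2 ≤ n → d ≠ -(2 * (j : K))) (D : Diagram n) :
    coeff (proj d n) D = weight d n (n - D.through) := by
  have hv : D.VerticalFrom n := fun i hi => absurd i.2 (not_lt.2 hi)
  have hc : n - D.through = D.capCount := by
    have := D.capCount_add_through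
    omega
  rw [proj, projStep_eq_symProj hn le_rfl hd, coeff_symProj, symCoeff, if_pos hv, hc]

theorem canonicalElement_eq_ofDiagram (r k : ℕ) (hk : k + 2 * r = n) :
    ∃ D : Diagram n, canonicalElement d n k = ofDiagram D ∧ ∀ i : Fin n,
      if (i : ℕ) < k then D.mate (Sum.inl i) = Sum.inr i
      else (D.mate (Sum.inl i)).isLeft = true := by
  induction r generalizing k with
  | zero =>
    refine ⟨permDiagram 1, ?_, fun i => ?_⟩
    · have h : (n - k) / 2 = 0 := by omega
      simp only [canonicalElement, h, List.range_zero, List.map_nil, List.prod_nil]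
      rfl
    · rw [if_pos (by omega)]; rfl
  | succ r ih =>
    obtain ⟨D, hD, hmate⟩ := ih (k + 2) (by omega)
    have hi : 1 ≤ k + 1 ∧ k + 1 < n := by omega
    have hne : (⟨k, by omega⟩ : Fin n) ≠ ⟨k + 1, hi.2⟩ := by simp
    have hprod : canonicalElement d n k =
        ofDiagram (hookDiagram ⟨k, by omega⟩ ⟨k + 1, hi.2⟩ hne) * canonicalElement d n (k + 2) := by
      have h1 : (n - k) / 2 = r + 1 := by omega
      have h2 : (n - (k + 2)) / 2 = r := by omega
      simp only [canonicalElement, h1, h2, List.range_succ_eq_map, List.map_cons, List.prod_cons,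
        List.map_map]
      congr 1
      · change e d n (k + 1) = _
        rw [e, dif_pos hi]; rfl
      · congr 2
        funext j
        simp only [Function.comp_apply]
        congr 1
        omega
    have ha := hmate ⟨k, by omega⟩
    have hb := hmate ⟨k + 1, hi.2⟩
    rw [if_pos (by simp)] at ha hb
    refine ⟨D.conj (swap (Sum.inl ⟨k + 1, hi.2⟩) (Sum.inr ⟨k, by omega⟩)), ?_, ?_⟩
    · rw [hprod, hD, ofDiagram_mul, loops_hookDiagram_of_ne _ _ (by rw [ha]; simp), pow_zero,
        one_smul, comp_hookDiagram_left, ha]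
    · intro i
      have hmi := hmate i
      rw [Diagram.conj_mate, Equiv.symm_swap]
      by_cases hib : i = ⟨k + 1, hi.2⟩
      · subst hib
        rw [if_neg (by simp), Equiv.swap_apply_left, D.mate_eq_iff.1 ha,
          Equiv.swap_apply_of_ne_of_ne (by simp) (by simp)]
        rfl
      have hib' : (i : ℕ) ≠ k + 1 := fun h => hib (Fin.ext h)
      have hne' : (Sum.inl i : Fin n ⊕ Fin n) ≠ Sum.inl ⟨k + 1, hi.2⟩ := fun h =>
        hib (Sum.inl_injective h)
      rw [Equiv.swap_apply_of_ne_of_ne hne' (by simp)]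
      by_cases hia : i = ⟨k, by omega⟩
      · subst hia
        rw [if_neg (by simp), ha, Equiv.swap_apply_right]
        rfl
      have hia' : (i : ℕ) ≠ k := fun h => hia (Fin.ext h)
      by_cases hik : (i : ℕ) < k
      · rw [if_pos (by omega)] at hmi
        rw [if_pos hik, hmi, Equiv.swap_apply_of_ne_of_ne (by simp) (by simpa using hia)]
      · rw [if_neg (by omega)] at hmi
        rw [if_neg hik]
        rcases hx : D.mate (Sum.inl i) with y | y
        · rw [Equiv.swap_apply_of_ne_of_ne _ (by simp)]
          · rfl
          · intro h
            rw [h] at hx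
            have := D.mate_eq_iff.1 hx
            rw [hb] at this
            simp at this
        · simp [hx] at hmi

theorem exists_canonicalElement_through {k : ℕ} (hk : k ≤ n) (hpar : Even (n - k)) :
    ∃ D : Diagram n, canonicalElement d n k = ofDiagram D ∧ D.through = k := by
  obtain ⟨r, hr⟩ := hpar
  obtain ⟨D, hD, hmate⟩ := canonicalElement_eq_ofDiagram (d := d) (n := n) r k (by omega)
  refine ⟨D, hD, ?_⟩
  rw [Diagram.through, ← min_eq_right hk, ← Fin.card_filter_val_lt]
  congr 1
  ext i
  have := hmate i
  simp only [Finset.mem_filter, Finset.mem_univ, true_and]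
  split_ifs at this with h
  · simp [this, h]
  · rcases hx : D.mate (Sum.inl i) with y | y
    · simp [h]
    · simp [hx] at this

theorem weight_succ_succ [CharZero K] (n j : ℕ) :
    weight d (n + 1) (2 * (j + 1)) =
      ((j + 1 : ℕ) : K) * (-2 / (((n + 1 : ℕ) : K) * (d + 2 * ((n + 1 : ℕ) : K) - 4))) *
        weight d n (2 * j) := by
  have hprod : ∏ i ∈ Finset.range j,
        -(2 * (((i + 1 : ℕ) : K) + 1)) /
          (d + 2 * ((n + 1 : ℕ) : K) - 4 - 2 * ((i + 1 : ℕ) : K)) =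
      ((j + 1 : ℕ) : K) *
        ∏ i ∈ Finset.range j, -(2 * ((i : K) + 1)) / (d + 2 * (n : K) - 4 - 2 * (i : K)) := by
    induction j with
    | zero => simp
    | succ j ih =>
      rw [Finset.prod_range_succ, Finset.prod_range_succ, ih]
      push_cast
      rw [show d + 2 * ((n : K) + 1) - 4 - 2 * ((j : K) + 1) = d + 2 * (n : K) - 4 - 2 * (j : K) by
        ring]
      ring
  rw [weight_two_mul, weight_two_mul, Finset.prod_range_succ', hprod, Nat.factorial_succ]
  generalize ∏ i ∈ Finset.range j, -(2 * ((i : K) + 1)) / (d + 2 * (n : K) - 4 - 2 * (i : K)) = P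
  push_cast
  rw [mul_inv, div_eq_mul_inv, div_eq_mul_inv, mul_inv]
  ring

end Main

end VirtualTL

theorem mainTheorem4 {K : Type*} [Field K] [CharZero K] (d : K) (n k : ℕ)
    (hk : k + 2 ≤ n) (hpar : Even (n - k))
    (hd : ∀ j : ℕ, j + 2 ≤ n → d ≠ -(2 * (j : K))) :
    ∃ (D : VirtualTL.Diagram n) (c : K),
      (VirtualTL.canonicalElement d n k = VirtualTL.ofDiagram D) ∧
      D.through = k ∧
      VirtualTL.IsCommonCoeff (VirtualTL.proj d (n - 1)) (k + 1) c ∧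
      VirtualTL.coeff (VirtualTL.proj d n) D =
        (((n - k) / 2 : ℕ) : K) * (-2 / ((n : K) * (d + 2 * (n : K) - 4))) * c := by
  obtain ⟨r, hr⟩ := hpar
  obtain ⟨j, rfl⟩ : ∃ j, r = j + 1 := ⟨r - 1, by omega⟩
  obtain ⟨m, rfl⟩ : ∃ m, n = m + 1 := ⟨n - 1, by omega⟩
  obtain ⟨D, hD, hDk⟩ := VirtualTL.exists_canonicalElement_through (d := d) (n := m + 1) (k := k)
    (by omega) ⟨_, hr⟩
  obtain ⟨X, -, hX⟩ := VirtualTL.exists_canonicalElement_through (d := d) (n := m) (k := k + 1)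
    (by omega) ⟨j, by omega⟩
  have hc : ∀ Y : VirtualTL.Diagram m, Y.through = k + 1 →
      VirtualTL.coeff (VirtualTL.proj d m) Y = VirtualTL.weight d m (2 * j) := fun Y hY => by
    rw [VirtualTL.coeff_proj (by omega) (fun j hj => hd j (by omega)), hY,
      show m - (k + 1) = 2 * j by omega]
  refine ⟨D, VirtualTL.weight d m (2 * j), hD, hDk, ⟨⟨X, hX⟩, hc⟩, ?_⟩
  rw [VirtualTL.coeff_proj (by omega) hd, hDk, show m + 1 - k = 2 * (j + 1) by omega,
    VirtualTL.weight_succ_succ, Nat.mul_div_cancel_left _ (by norm_num)]
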